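/- Let $\mathcal T\subset\mathbb R^n$ be a nonempty closed set with compact boundary, let $\mathbf d(x)=\operatorname{dist}(x,\mathcal T)$, and put $X:=\mathbb R^n\setminus\mathcal T$. Let $f_1,\dots,f_m$ be vector fields on $X$ such that, for every bounded open set $\Omega\subset\mathbb R^n$, each $f_i$ is bounded and Lipschitz continuous on $\Omega\setminus\mathcal T$. Let $A=\{\pm e_1,\dots,\pm e_m\}\subset\mathbb R^m$ and consider the control system $$\dot y=\sum_{i=1}^m a_i f_i(y),\qquad y(0)=x\in X,\qquad a\in A. \tag{1}$$ **Set-valued brackets and Hamiltonian.** Where $f,g$ are differentiable let $[f,g]=Dg\cdot f-Df\cdot g$. For $x\in X$ let $$[f_i,f_j]_{set}(x)=\operatorname{co}\Big\{v:\ v=\lim_k\,[f_i,f_j](x_k)\ \text{for some sequence } x_k\to x,\ x_k\in X \text{ points of differentiability of both } f_i \text{ and } f_j\Big\},$$ where $\operatorname{co}$ is the convex hull. Let $\mathcal F^{(2)}(x)$ be the family consisting of the sets $\{f_\ell(x)\}$, $\{-f_\ell(x)\}$ $(1\le\ell\le m)$ and $[f_i,f_j]_{set}(x)$ $(1\le i,j\le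 m)$, and let $$H^{(2)}(x,p)=\inf_{v\in\mathcal F^{(2)}(x)}\ \sup_{w\in v}\ \langle p,w\rangle ,\qquad (x,p)\in X\times\mathbb R^n .$$ **Degree-2 control Lyapunov function.** This is a continuous function $U:\overline{X}\to\mathbb R$ such that * for every compact $K\subset X$ there is $\rho>0$ with $U(z_1)+U(z_2)-2U\big(\tfrac{z_1+z_2}2\big)\le\rho|z_1-z_2|^2$ whenever $z_1,z_2\in K$ and the segment $[z_1,z_2]$ lies in $K$; * $U>0$ on $X$ and $U=0$ on $\partial\mathcal T$; * $U^{-1}(K)$ is compact for every compact $K\subset[0,\infty)$; * $H^{(2)}(x,p)<0$ for every $x\in X$ and every $p\in D^*U(x)$, where $D^*U(x)$ is the set of all limits $\lim_k\nabla U(x_k)$ along sequences $x_k\to x$, $x_k\ne x$, of points of $X$ at which $U$ is differentiable. **Global asymptotic controllability.** $\mathcal{KL}$ is the set of continuous $\beta:[0,\infty)^2\to[0,\infty)$ such that, for all $\delta,s\ge0$: $\beta(0,s)=0$; $\beta(\cdot,s)$ is strictly increasing and unbounded; $\beta(\delta,\cdot)$ is nonincreasing; and $\beta(\delta,r)\to0$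 as $r\to\infty$. System (1) is *globally asymptotically controllable (GAC) to $\mathcal T$* if there is $\beta\in\mathcal{KL}$ such that for each $x\in X$ there are a measurable control $\alpha:[0,\infty)\to A$, a time $S\in(0,+\infty]$ and a (Carathéodory) solution $y:[0,S)\to X$ of $\dot y=\sum_i\alpha_i f_i(y)$, $y(0)=x$, with $\lim_{t\to S^-}\mathbf d(y(t))=0$ and $$\mathbf d(y(t))\le\beta(\mathbf d(x),t)\qquad\text{for all } t\ge0,$$ where, if $S<+\infty$, $y$ is prolonged to $[S,\infty)$ by a constant $\bar x\in\partial\mathcal T$. **Theorem.** If a degree-2 control Lyapunov function exists, then system (1) is GAC to $\mathcal T$. -/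

import Mathlib

open Set Filter Topology

noncomputable section

namespace LieCLF

/-- The state space `ℝⁿ` with its Euclidean norm. -/
abbrev State (n : ℕ) : Type := EuclideanSpace ℝ (Fin n)

/-! ### Regularity of the vector fields and set-valued brackets -/

/-- The class `C_b^{0,1}(S)`: bounded, (globally) Lipschitz continuous vector fields on `S`. -/
def IsCb01On {n : ℕ} (g : State n → State n) (S : Set (State n)) : Prop :=
  (∃ M : ℝ, ∀ x ∈ S, ‖g x‖ ≤ M) ∧ ∃ K : NNReal, LipschitzOnWith K g S

/-- The limits of classical Lie brackets `[f,g](x_k) = Dg(x_k) f(x_k) - Df(x_k) g(x_k)` along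
sequences `x_k → x` in `Ω` at which both `f` and `g` are differentiable. -/
def limitBrackets {n : ℕ} (Ω : Set (State n)) (f g : State n → State n) (x : State n) :
    Set (State n) :=
  {v | ∃ u : ℕ → State n,
    (∀ k, u k ∈ Ω ∧ DifferentiableAt ℝ f (u k) ∧ DifferentiableAt ℝ g (u k)) ∧
    Tendsto u atTop (𝓝 x) ∧
    Tendsto (fun k => VectorField.lieBracket ℝ f g (u k)) atTop (𝓝 v)}

/-- The set-valued Lie bracket `[f,g]_set(x)`. -/
def setBracket {n : ℕ} (Ω : Set (State n)) (f g : State n → State n) (x : State n) :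
    Set (State n) :=
  convexHull ℝ (limitBrackets Ω f g x)

/-- `𝓕⁽¹⁾(x) = { {f_ℓ(x)}, {-f_ℓ(x)} : ℓ = 1, …, m }`, a family of subsets of `ℝⁿ`. -/
def family1 {n m : ℕ} (f : Fin m → State n → State n) (x : State n) : Set (Set (State n)) :=
  {v | ∃ l : Fin m, v = {f l x} ∨ v = {-f l x}}

/-- `𝓕⁽²⁾(x) = 𝓕⁽¹⁾(x) ∪ { [f_i,f_j]_set(x) : i, j = 1, …, m }`. -/
def family2 {n m : ℕ} (Ω : Set (State n)) (f : Fin m → State n → State n) (x : State n) :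
    Set (Set (State n)) :=
  family1 f x ∪ {v | ∃ i j : Fin m, v = setBracket Ω (f i) (f j) x}

/-- The degree-2 Hamiltonian `H⁽²⁾(x,p) = inf_{v ∈ 𝓕⁽²⁾(x)} sup_{w ∈ v} ⟨p,w⟩`.
For `f_1, …, f_m` locally Lipschitz on the open set `Ω ∋ x` the family `𝓕⁽²⁾(x)` is finite and its
members are nonempty and compact, so the infimum and the suprema are genuine ones as soon as
`m ≥ 1`. (For `m = 0` the value is `0`, so that `H⁽²⁾(x,p) < 0` fails, as it does for `inf ∅ = ∞`.)
-/
def hamiltonian2 {n m : ℕ} (Ω : Set (State n)) (f : Fin m → State n → State n)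
    (x p : State n) : ℝ :=
  sInf ((fun v : Set (State n) => sSup ((fun w => inner ℝ p w) '' v)) '' family2 Ω f x)

/-! ### Control Lyapunov functions -/

/-- `F` is semiconcave on `S`. -/
def SemiconcaveOn {n : ℕ} (F : State n → ℝ) (S : Set (State n)) : Prop :=
  ContinuousOn F S ∧ ∃ ρ : ℝ, 0 < ρ ∧ ∀ z₁ ∈ S, ∀ z₂ ∈ S, segment ℝ z₁ z₂ ⊆ S →
    F z₁ + F z₂ - 2 * F (midpoint ℝ z₁ z₂) ≤ ρ * ‖z₁ - z₂‖ ^ 2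

/-- `F` is locally semiconcave on `Ω`: semiconcave on every compact subset of `Ω`. -/
def LocallySemiconcaveOn {n : ℕ} (F : State n → ℝ) (Ω : Set (State n)) : Prop :=
  ∀ K : Set (State n), K ⊆ Ω → IsCompact K → SemiconcaveOn F K

/-- The set `D*F(x)` of limiting gradients at `x` of a function `F` on the open set `Ω`. -/
def limitingGradients {n : ℕ} (Ω : Set (State n)) (F : State n → ℝ) (x : State n) :
    Set (State n) :=
  {w | ∃ u : ℕ → State n,
    (∀ k, u k ∈ Ω ∧ DifferentiableAt ℝ F (u k) ∧ u k ≠ x) ∧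
    Tendsto u atTop (𝓝 x) ∧
    Tendsto (fun k => gradient F (u k)) atTop (𝓝 w)}

/-- `U` is a degree-2 control Lyapunov function for the fields `f` and the target `T`. Only the
values of `U` on `closure Tᶜ` and those of the `f i` on `Tᶜ` matter. -/
structure IsDegreeTwoCLF {n m : ℕ} (f : Fin m → State n → State n) (T : Set (State n))
    (U : State n → ℝ) : Prop where
  continuousOn : ContinuousOn U (closure Tᶜ)
  locallySemiconcave : LocallySemiconcaveOn U Tᶜ
  pos : ∀ x ∈ Tᶜ, 0 < U x
  zero : ∀ x ∈ frontier T, U x = 0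
  proper : ∀ K : Set ℝ, K ⊆ Ici 0 → IsCompact K → IsCompact (closure Tᶜ ∩ U ⁻¹' K)
  decrease : ∀ x ∈ Tᶜ, ∀ p ∈ limitingGradients Tᶜ U x, hamiltonian2 Tᶜ f x p < 0

/-! ### Trajectories and global asymptotic controllability -/

/-- The control set `A = {±e_1, …, ±e_m} ⊆ ℝᵐ`. -/
def controlSet (m : ℕ) : Set (Fin m → ℝ) :=
  {a | ∃ i : Fin m, a = Pi.single i 1 ∨ a = -Pi.single i 1}

/-- `y` is a (Carathéodory) solution on `[0,S)`, `0 < S ≤ +∞`, of `y' = ∑ i, α_i f_i(y)`, `y(0) = x`,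
with values in the domain `Tᶜ` of the vector fields. -/
structure IsSolution {n m : ℕ} (f : Fin m → State n → State n) (T : Set (State n))
    (x : State n) (y : ℝ → State n) (α : ℝ → Fin m → ℝ) (S : EReal) : Prop where
  pos : 0 < S
  init : y 0 = x
  continuousOn : ContinuousOn y {t : ℝ | 0 ≤ t ∧ (t : EReal) < S}
  mem : ∀ t : ℝ, 0 ≤ t → (t : EReal) < S → y t ∈ Tᶜ
  integrable : ∀ t : ℝ, 0 ≤ t → (t : EReal) < S →
    IntervalIntegrable (fun s => ∑ i, α s i • f i (y s)) MeasureTheory.volume 0 t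
  eq : ∀ t : ℝ, 0 ≤ t → (t : EReal) < S → y t = x + ∫ s in (0 : ℝ)..t, ∑ i, α s i • f i (y s)

/-- `(y,α)` is an admissible trajectory-control pair from `x`, defined up to `S ≤ +∞`: `α` is a
measurable control with values in `A`, `y` is a solution on `[0,S)`, and the distance of `y(t)` from
the target tends to `0` as `t → S`. -/
structure IsAdmissible {n m : ℕ} (f : Fin m → State n → State n) (T : Set (State n))
    (x : State n) (y : ℝ → State n) (α : ℝ → Fin m → ℝ) (S : EReal) : Prop where
  measurable : Measurable α
  control_mem : ∀ t : ℝ, 0 ≤ t → α t ∈ controlSet m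
  solution : IsSolution f T x y α S
  limit_of_top : S = ⊤ → Tendsto (fun t => Metric.infDist (y t) T) atTop (𝓝 0)
  limit_of_real : ∀ r : ℝ, S = r → Tendsto (fun t => Metric.infDist (y t) T) (𝓝[<] r) (𝓝 0)

/-- The class `KL` of comparison functions `β : [0,∞) × [0,∞) → [0,∞)`. -/
structure IsKL (β : ℝ → ℝ → ℝ) : Prop where
  continuousOn : ContinuousOn (Function.uncurry β) (Ici 0 ×ˢ Ici 0)
  nonneg : ∀ δ s : ℝ, 0 ≤ δ → 0 ≤ s → 0 ≤ β δ s
  zero : ∀ s : ℝ, 0 ≤ s → β 0 s = 0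
  strictMono : ∀ s : ℝ, 0 ≤ s → StrictMonoOn (fun δ => β δ s) (Ici 0)
  unbounded : ∀ s : ℝ, 0 ≤ s → ∀ M : ℝ, ∃ δ : ℝ, 0 ≤ δ ∧ M < β δ s
  antitone : ∀ δ : ℝ, 0 ≤ δ → AntitoneOn (fun s => β δ s) (Ici 0)
  tendsto : ∀ δ : ℝ, 0 ≤ δ → Tendsto (fun s => β δ s) atTop (𝓝 0)

/-- The system `y' = ∑ i, a_i f_i(y)`, `a ∈ A`, is globally asymptotically controllable to `T`.
If `S < +∞`, the trajectory is prolonged to `[S,∞)` by a constant `x̄ ∈ ∂T`. -/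
def IsGAC {n m : ℕ} (f : Fin m → State n → State n) (T : Set (State n)) : Prop :=
  ∃ β : ℝ → ℝ → ℝ, IsKL β ∧ ∀ x ∈ Tᶜ,
    ∃ (y : ℝ → State n) (α : ℝ → Fin m → ℝ) (S : EReal),
      IsAdmissible f T x y α S ∧
      (∃ xbar ∈ frontier T, ∀ t : ℝ, S ≤ (t : EReal) → y t = xbar) ∧
      ∀ t : ℝ, 0 ≤ t → Metric.infDist (y t) T ≤ β (Metric.infDist x T) t

end LieCLF

end

/-!
Near a point `x₀` outside `T` the semiconcave function `U` is Lipschitz, so a limiting gradient `p`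
exists at `x₀`, and semiconcavity gives `U y ≤ U x₀ + ⟪p, y - x₀⟫ + C ‖y - x₀‖²`. As
`H⁽²⁾(x₀, p) < 0`, either some `±f_i(x₀)` or a whole set `[f_i, f_j]_set(x₀)` lies in a half-space
`⟪p, ·⟫ ≤ c` with `c < 0`. In the first case one follows `±f_i` for a short time `t`, and the
displacement has size `O(t)` and `p`-component at most `c t + o(t)`. In the second case one follows
`f_i`, `f_j`, `-f_i`, `-f_j`, each for time `t`. Up to `o(t²)`, the displacement is the circulation
along the boundary of the parallelogram with sides `t f_i(x₀)` and `t f_j(x₀)` of the one-form with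
values `f_i`, `f_j` on these sides. Green's formula, valid for Lipschitz fields on almost every
translate of the parallelogram, expresses the circulation through derivatives at points of
differentiability near `x₀`, so the displacement has size `O(t²)` and `p`-component at most
`c t² + o(t²)`. In both cases the quadratic error `C ‖y - x₀‖²` is negligible and `U` decreases.

By compactness the decrease is uniform on each shell `{a ≤ U ≤ b}`, `0 < a`. From every `x` one can
therefore halve `U` while at most doubling it on the way, in a time bounded on shells. Iterating
this keeps `U` below `2 U(x)` and drives it to `0` uniformly on `{U ≤ b}`. Since `U` is proper and
vanishes exactly on `∂T`, the distance to `T` is uniformly bounded, stable and attractive, and such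
a family is dominated by a function `β ∈ KL`.
-/

namespace LieCLF

/-! ### Comparison functions -/

section ComparisonFunctions

/-- The class `K∞` of comparison functions: continuous, strictly increasing and unbounded on
`[0,∞)`, vanishing at `0`. -/
structure IsKInfty (G : ℝ → ℝ) : Prop where
  continuousOn : ContinuousOn G (Ici 0)
  zero : G 0 = 0
  strictMonoOn : StrictMonoOn G (Ici 0)
  tendsto : Tendsto G atTop atTop

/-- The class `L` of comparison functions, restricted to positive ones: continuous, nonincreasing
on `[0,∞)` and tending to `0` at infinity. -/
structure IsClassL (Ψ : ℝ → ℝ) : Prop where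
  continuousOn : ContinuousOn Ψ (Ici 0)
  pos : ∀ t, 0 ≤ t → 0 < Ψ t
  antitoneOn : AntitoneOn Ψ (Ici 0)
  tendsto : Tendsto Ψ atTop (𝓝 0)

theorem IsKInfty.nonneg {G : ℝ → ℝ} (hG : IsKInfty G) {x : ℝ} (hx : 0 ≤ x) : 0 ≤ G x :=
  hG.zero ▸ hG.strictMonoOn.monotoneOn self_mem_Ici hx hx

theorem IsKInfty.isKL_sqrt_mul {G Ψ : ℝ → ℝ} (hG : IsKInfty G) (hΨ : IsClassL Ψ) :
    IsKL fun δ t => √(G δ * Ψ t) where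
  continuousOn :=
    ((hG.continuousOn.comp continuousOn_fst fun _ hp => hp.1).mul
      (hΨ.continuousOn.comp continuousOn_snd fun _ hp => hp.2)).sqrt
  nonneg _ _ _ _ := Real.sqrt_nonneg _
  zero s _ := by simp [hG.zero]
  strictMono s hs x hx z hz hxz :=
    Real.sqrt_lt_sqrt (mul_nonneg (hG.nonneg hx) (hΨ.pos s hs).le)
      (mul_lt_mul_of_pos_right (hG.strictMonoOn hx hz hxz) (hΨ.pos s hs))
  unbounded s hs M :=
    have h : Tendsto (fun δ => √(G δ * Ψ s)) atTop atTop :=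
      Real.tendsto_sqrt_atTop.comp (hG.tendsto.atTop_mul_const (hΨ.pos s hs))
    ((eventually_ge_atTop 0).and (h.eventually_gt_atTop M)).exists
  antitone δ hδ s hs t ht hst :=
    Real.sqrt_le_sqrt (mul_le_mul_of_nonneg_left (hΨ.antitoneOn hs ht hst) (hG.nonneg hδ))
  tendsto δ _ := by simpa using (hΨ.tendsto.const_mul (G δ)).sqrt

/-- The average of `g` over `[x, 2 * x]`, written as an integral over the dilations `r ∈ [1, 2]`. It
regularizes a monotone function without changing its value `g 0` at the origin. -/
noncomputable def dilationAverage (g : ℝ → ℝ) (x : ℝ) : ℝ := ∫ r in (1 : ℝ)..2, g (x * r)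

section dilationAverage

variable {g : ℝ → ℝ}

theorem dilationAverage_zero (g : ℝ → ℝ) : dilationAverage g 0 = g 0 := by
  norm_num [dilationAverage]

theorem intervalIntegrable_comp_dilation (hg : Monotone g) {x : ℝ} (hx : 0 ≤ x) :
    IntervalIntegrable (fun r => g (x * r)) MeasureTheory.volume 1 2 :=
  (hg.comp (monotone_id.const_mul hx)).intervalIntegrable

theorem le_dilationAverage (hg : Monotone g) {x : ℝ} (hx : 0 ≤ x) : g x ≤ dilationAverage g x := by
  have h := intervalIntegral.integral_mono_on one_le_two (intervalIntegrable_const (c := g x))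
    (intervalIntegrable_comp_dilation hg hx) fun r hr => hg (le_mul_of_one_le_right hx hr.1)
  norm_num at h
  exact h

theorem dilationAverage_le (hg : Monotone g) {x : ℝ} (hx : 0 ≤ x) :
    dilationAverage g x ≤ g (x * 2) := by
  have h := intervalIntegral.integral_mono_on one_le_two (intervalIntegrable_comp_dilation hg hx)
    (intervalIntegrable_const (c := g (x * 2))) fun r hr =>
      hg (mul_le_mul_of_nonneg_left hr.2 hx)
  norm_num at h
  exact h

theorem monotoneOn_dilationAverage (hg : Monotone g) : MonotoneOn (dilationAverage g) (Ici 0) :=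
  fun _ hx _ hz hxz => intervalIntegral.integral_mono_on one_le_two
    (intervalIntegrable_comp_dilation hg hx) (intervalIntegrable_comp_dilation hg hz) fun _ hr =>
      hg (mul_le_mul_of_nonneg_right hxz (zero_le_one.trans hr.1))

theorem continuousAt_dilationAverage (hg : Monotone g) {x : ℝ} (hx : x ≠ 0) :
    ContinuousAt (dilationAverage g) x := by
  have hprim : Continuous fun u : ℝ => ∫ r in (0 : ℝ)..u, g r :=
    intervalIntegral.continuous_primitive (fun _ _ => hg.intervalIntegrable) 0
  have heq : dilationAverage g =ᶠ[𝓝 x]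
      fun z => z⁻¹ * ((∫ r in (0 : ℝ)..z * 2, g r) - ∫ r in (0 : ℝ)..z * 1, g r) := by
    filter_upwards [eventually_ne_nhds hx] with z hz
    rw [intervalIntegral.integral_interval_sub_left hg.intervalIntegrable hg.intervalIntegrable,
      ← intervalIntegral.mul_integral_comp_mul_left, inv_mul_cancel_left₀ hz, dilationAverage]
  rw [continuousAt_congr heq]
  exact (continuousAt_inv₀ hx).mul
    ((hprim.comp (continuous_mul_const 2)).continuousAt.sub
      (hprim.comp (continuous_mul_const 1)).continuousAt)

theorem continuousWithinAt_dilationAverage_zero (hg : Monotone g)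
    (hlim : Tendsto g (𝓝[>] 0) (𝓝 (g 0))) : ContinuousWithinAt (dilationAverage g) (Ici 0) 0 := by
  have hdouble : Tendsto (fun x : ℝ => x * 2) (𝓝[>] 0) (𝓝[>] 0) := by
    refine tendsto_nhdsWithin_iff.2 ⟨?_, ?_⟩
    · exact ((continuous_mul_const (2 : ℝ)).tendsto' 0 0 (zero_mul 2)).mono_left nhdsWithin_le_nhds
    · filter_upwards [self_mem_nhdsWithin] with x hx using mul_pos hx (zero_lt_two' ℝ)
  rw [← continuousWithinAt_Ioi_iff_Ici, ContinuousWithinAt, dilationAverage_zero]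
  refine tendsto_of_tendsto_of_tendsto_of_le_of_le' hlim (hlim.comp hdouble) ?_ ?_ <;>
    filter_upwards [self_mem_nhdsWithin] with x hx
  exacts [le_dilationAverage hg (le_of_lt hx), dilationAverage_le hg (le_of_lt hx)]

end dilationAverage

theorem exists_isKInfty_ge {g : ℝ → ℝ} (hg : Monotone g) (h0 : g 0 = 0)
    (hlim : Tendsto g (𝓝[>] 0) (𝓝 0)) : ∃ G, IsKInfty G ∧ ∀ x, 0 ≤ x → g x ≤ G x := by
  have hnonneg : ∀ x, 0 ≤ x → 0 ≤ dilationAverage g x := fun x hx =>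
    (h0 ▸ hg hx).trans (le_dilationAverage hg hx)
  refine ⟨fun x => x + dilationAverage g x, ⟨?_, ?_, ?_, ?_⟩, fun x hx =>
    (le_dilationAverage hg hx).trans (le_add_of_nonneg_left hx)⟩
  · refine continuousOn_id.add fun x hx => ?_
    rcases eq_or_ne x 0 with rfl | hne
    · exact continuousWithinAt_dilationAverage_zero hg (h0.symm ▸ hlim)
    · exact (continuousAt_dilationAverage hg hne).continuousWithinAt
  · simp only [dilationAverage_zero, h0, add_zero]
  · exact fun x hx z hz hxz =>
      add_lt_add_of_lt_of_le hxz (monotoneOn_dilationAverage hg hx hz hxz.le)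
  · refine tendsto_atTop_mono' _ ?_ tendsto_id
    filter_upwards [eventually_ge_atTop 0] with x hx using le_add_of_nonneg_right (hnonneg x hx)

theorem exists_isClassL_ge {ψ : ℝ → ℝ} (hψ : Antitone ψ) (hlim : Tendsto ψ atTop (𝓝 0)) :
    ∃ Ψ, IsClassL Ψ ∧ ∀ t, ψ t ≤ Ψ t := by
  let avg : ℝ → ℝ := fun t => ∫ r in (t - 1)..t, ψ r
  have hint : ∀ a b, IntervalIntegrable ψ MeasureTheory.volume a b := fun _ _ =>
    hψ.intervalIntegrable
  have hle : ∀ t, ψ t ≤ avg t := fun t => by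
    simpa using intervalIntegral.integral_mono_on (sub_le_self t zero_le_one)
      intervalIntegrable_const (hint (t - 1) t) fun r hr => hψ hr.2
  have hge : ∀ t, avg t ≤ ψ (t - 1) := fun t => by
    simpa using intervalIntegral.integral_mono_on (sub_le_self t zero_le_one)
      (hint (t - 1) t) intervalIntegrable_const fun r hr => hψ hr.1
  have hnonneg : ∀ t, 0 ≤ avg t := fun t => (hψ.le_of_tendsto hlim t).trans (hle t)
  have hcont : Continuous avg := by
    have hprim := intervalIntegral.continuous_primitive hint 0
    have heq : avg = fun t => (∫ r in (0 : ℝ)..t, ψ r) - ∫ r in (0 : ℝ)..t - 1, ψ r := by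
      funext t
      rw [intervalIntegral.integral_interval_sub_left (hint _ _) (hint _ _)]
    rw [heq]
    exact hprim.sub (hprim.comp (continuous_sub_right 1))
  have hanti : Antitone avg := by
    intro s t hst
    have hshift : ∀ u, avg u = ∫ r in (0 : ℝ)..1, ψ (u - r) := fun u => by
      simp only [avg, intervalIntegral.integral_comp_sub_left, sub_zero]
    rw [hshift, hshift]
    have hint' : ∀ u, IntervalIntegrable (fun r => ψ (u - r)) MeasureTheory.volume 0 1 := fun u =>
      Monotone.intervalIntegrable fun r r' h => hψ (sub_le_sub_left h u)
    exact intervalIntegral.integral_mono_on zero_le_one (hint' t) (hint' s) fun r _ =>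
      hψ (sub_le_sub_right hst r)
  have havg : Tendsto avg atTop (𝓝 0) :=
    tendsto_of_tendsto_of_tendsto_of_le_of_le hlim
      (hlim.comp (tendsto_atTop_add_const_right _ (-1) tendsto_id)) hle hge
  refine ⟨fun t => Real.exp (-t) + avg t, ⟨?_, ?_, ?_, ?_⟩, fun t =>
    (hle t).trans (le_add_of_nonneg_left (Real.exp_pos _).le)⟩
  · exact ((by fun_prop : Continuous fun t => Real.exp (-t)).add hcont).continuousOn
  · exact fun t _ => add_pos_of_pos_of_nonneg (Real.exp_pos _) (hnonneg t)
  · exact fun s _ t _ hst => 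
      add_le_add (Real.exp_le_exp.2 (neg_le_neg hst)) (hanti hst)
  · simpa using Real.tendsto_exp_neg_atTop_nhds_zero.add havg

theorem exists_antitone_tendsto_le_mul {ψ : ℕ → ℝ → ℝ} (hψ : ∀ k, Antitone (ψ k))
    (hlim : ∀ k, Tendsto (ψ k) atTop (𝓝 0)) {B : ℕ → ℝ} (hB : ∀ k t, ψ k t ≤ B k) :
    ∃ (Ψ : ℝ → ℝ) (c : ℕ → ℝ), Antitone Ψ ∧ Tendsto Ψ atTop (𝓝 0) ∧ (∀ k, 0 < c k) ∧
      ∀ k t, ψ k t ≤ c k * Ψ t := by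
  have hnonneg : ∀ k t, 0 ≤ ψ k t := fun k t => (hψ k).le_of_tendsto (hlim k) t
  have hB0 : ∀ k, 0 < B k + 1 := fun k => by linarith [hnonneg k 0, hB k 0]
  let c : ℕ → ℝ := fun k => 2 ^ k * (B k + 1)
  have hc : ∀ k, 0 < c k := fun k => mul_pos (by positivity) (hB0 k)
  have hterm : ∀ k t, 0 ≤ ψ k t / c k := fun k t => div_nonneg (hnonneg k t) (hc k).le
  have hterm_le : ∀ k t, ψ k t / c k ≤ (1 / 2) ^ k := fun k t => by
    rw [div_le_iff₀ (hc k), ← mul_assoc, ← mul_pow]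
    norm_num
    linarith [hB k t]
  have hsum : ∀ t, Summable fun k => ψ k t / c k := fun t =>
    summable_geometric_two.of_nonneg_of_le (hterm · t) (hterm_le · t)
  refine ⟨fun t => ∑' k, ψ k t / c k, c, fun s t hst => ?_, ?_, hc, fun k t => ?_⟩
  · exact (hsum t).tsum_le_tsum (fun k => div_le_div_of_nonneg_right (hψ k hst) (hc k).le) (hsum s)
  · simpa using tendsto_tsum_of_dominated_convergence summable_geometric_two
      (fun k => (hlim k).div_const (c k)) (Eventually.of_forall fun t k => by
        rw [Real.norm_of_nonneg (hterm k t)]; exact hterm_le k t)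
  · exact (div_le_iff₀' (hc k)).1 ((hsum t).le_tsum k fun j _ => hterm j t)

variable {ι : Type*} {r : ι → ℝ} {D : ι → ℝ → ℝ}

/-- Trajectories starting at size at most `R` keep their sizes `D i t`, `t ≥ 0`, below a bound
depending on `R` only. Here `r i` is the initial size of the trajectory `i`. -/
def UniformlyBounded (r : ι → ℝ) (D : ι → ℝ → ℝ) : Prop :=
  ∀ R, ∃ M, ∀ i, r i ≤ R → ∀ t, 0 ≤ t → D i t ≤ M

/-- Trajectories starting at sufficiently small size stay at small size. -/
def UniformlyStable (r : ι → ℝ) (D : ι → ℝ → ℝ) : Prop :=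
  ∀ ε > 0, ∃ δ > 0, ∀ i, r i ≤ δ → ∀ t, 0 ≤ t → D i t ≤ ε

/-- The size of the trajectories tends to `0`, uniformly with respect to bounded initial sizes. -/
def UniformlyAttractive (r : ι → ℝ) (D : ι → ℝ → ℝ) : Prop :=
  ∀ R, ∀ ε > 0, ∃ τ, ∀ i, r i ≤ R → ∀ t, 0 ≤ t → τ ≤ t → D i t ≤ ε

/-- The supremum of the sizes reached after time `t` by trajectories of initial size at most `δ`;
`0` is inserted so that it is nonnegative, also when there is no such trajectory. -/
noncomputable def tailSup (r : ι → ℝ) (D : ι → ℝ → ℝ) (δ t : ℝ) : ℝ :=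
  sSup (insert 0 ((fun p : ι × ℝ => D p.1 p.2) '' {p | r p.1 ≤ δ ∧ 0 ≤ p.2 ∧ t ≤ p.2}))

theorem tailSup_le {δ t ε : ℝ} (hε : 0 ≤ ε)
    (h : ∀ i, r i ≤ δ → ∀ s, 0 ≤ s → t ≤ s → D i s ≤ ε) : tailSup r D δ t ≤ ε := by
  refine csSup_le (insert_nonempty _ _) ?_
  rintro _ (rfl | ⟨p, ⟨hδ, h0, ht⟩, rfl⟩)
  exacts [hε, h p.1 hδ p.2 h0 ht]

theorem tailSup_eq_zero {δ : ℝ} (h : ∀ i, δ < r i) (t : ℝ) : tailSup r D δ t = 0 := by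
  have hempty : {p : ι × ℝ | r p.1 ≤ δ ∧ 0 ≤ p.2 ∧ t ≤ p.2} = ∅ :=
    eq_empty_of_forall_notMem fun p hp => (h p.1).not_ge hp.1
  simp [tailSup, hempty]

namespace UniformlyBounded

theorem bddAbove_tail (hb : UniformlyBounded r D) (δ t : ℝ) :
    BddAbove (insert 0
      ((fun p : ι × ℝ => D p.1 p.2) '' {p | r p.1 ≤ δ ∧ 0 ≤ p.2 ∧ t ≤ p.2})) := by
  obtain ⟨M, hM⟩ := hb δ
  refine BddAbove.insert 0 ⟨M, ?_⟩
  rintro _ ⟨p, ⟨hδ, h0, -⟩, rfl⟩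
  exact hM p.1 hδ p.2 h0

theorem tailSup_nonneg (hb : UniformlyBounded r D) (δ t : ℝ) : 0 ≤ tailSup r D δ t :=
  le_csSup (hb.bddAbove_tail δ t) (mem_insert _ _)

theorem le_tailSup (hb : UniformlyBounded r D) {i : ι} {δ t : ℝ} (hi : r i ≤ δ) (ht : 0 ≤ t) :
    D i t ≤ tailSup r D δ t :=
  le_csSup (hb.bddAbove_tail δ t) (mem_insert_of_mem _ ⟨(i, t), ⟨hi, ht, le_rfl⟩, rfl⟩)

theorem monotone_tailSup (hb : UniformlyBounded r D) (t : ℝ) :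
    Monotone fun δ => tailSup r D δ t := fun _ _ h =>
  csSup_le_csSup (hb.bddAbove_tail _ _) (insert_nonempty _ _) <|
    insert_subset_insert <| image_mono fun _ hp => ⟨hp.1.trans h, hp.2⟩

theorem antitone_tailSup (hb : UniformlyBounded r D) (δ : ℝ) : Antitone (tailSup r D δ) :=
  fun _ _ h => csSup_le_csSup (hb.bddAbove_tail _ _) (insert_nonempty _ _) <|
    insert_subset_insert <| image_mono fun _ hp => ⟨hp.1, hp.2.1, h.trans hp.2.2⟩

theorem tailSup_le_zero_time (hb : UniformlyBounded r D) (δ t : ℝ) :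
    tailSup r D δ t ≤ tailSup r D δ 0 :=
  tailSup_le (hb.tailSup_nonneg _ _) fun _ hi _ h0 _ =>
    (hb.le_tailSup hi h0).trans (hb.antitone_tailSup δ h0)

theorem tendsto_tailSup_atTop (hb : UniformlyBounded r D) (ha : UniformlyAttractive r D) (δ : ℝ) :
    Tendsto (tailSup r D δ) atTop (𝓝 0) := by
  refine tendsto_order.2 ⟨fun a h => .of_forall fun t => h.trans_le (hb.tailSup_nonneg δ t),
    fun a h => ?_⟩
  obtain ⟨τ, hτ⟩ := ha δ (a / 2) (half_pos h)
  filter_upwards [eventually_ge_atTop τ] with t ht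
  exact (tailSup_le (half_pos h).le fun i hi s h0 hs =>
    hτ i hi s h0 (ht.trans hs)).trans_lt (half_lt_self h)

theorem tendsto_tailSup_nhdsGT (hb : UniformlyBounded r D) (hs : UniformlyStable r D) (t : ℝ) :
    Tendsto (fun δ => tailSup r D δ t) (𝓝[>] 0) (𝓝 0) := by
  refine tendsto_order.2 ⟨fun a h => .of_forall fun δ => h.trans_le (hb.tailSup_nonneg δ t),
    fun a h => ?_⟩
  obtain ⟨δ₀, hδ₀, h0⟩ := hs (a / 2) (half_pos h)
  filter_upwards [Ioc_mem_nhdsGT hδ₀] with δ hδ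
  exact (tailSup_le (half_pos h).le fun i hi s h1 _ =>
    h0 i (hi.trans hδ.2) s h1).trans_lt (half_lt_self h)

theorem exists_tailSup_le_mul (hb : UniformlyBounded r D) (ha : UniformlyAttractive r D) :
    ∃ C Ψ : ℝ → ℝ, Monotone C ∧ (∀ δ, 0 ≤ C δ) ∧ IsClassL Ψ ∧
      ∀ δ t, 0 ≤ t → tailSup r D δ t ≤ C δ * Ψ t := by
  obtain ⟨ψ, c, hψ, hψ0, hc, hle⟩ := exists_antitone_tendsto_le_mul
    (fun k : ℕ => hb.antitone_tailSup k) (fun k => hb.tendsto_tailSup_atTop ha k)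
    (fun k t => hb.tailSup_le_zero_time k t)
  obtain ⟨Ψ, hΨ, hψΨ⟩ := exists_isClassL_ge hψ hψ0
  refine ⟨fun δ => ∑ k ∈ Finset.range (⌈δ⌉₊ + 1), c k, Ψ, fun δ δ' h => ?_,
    fun δ => Finset.sum_nonneg fun k _ => (hc k).le, hΨ, fun δ t ht => ?_⟩
  · exact Finset.sum_le_sum_of_subset_of_nonneg
      (Finset.range_mono (Nat.succ_le_succ (Nat.ceil_mono h))) fun k _ _ => (hc k).le
  · calc tailSup r D δ t ≤ tailSup r D (⌈δ⌉₊ : ℝ) t := hb.monotone_tailSup t (Nat.le_ceil δ)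
      _ ≤ c ⌈δ⌉₊ * ψ t := hle _ t
      _ ≤ c ⌈δ⌉₊ * Ψ t := mul_le_mul_of_nonneg_left (hψΨ t) (hc _).le
      _ ≤ _ := mul_le_mul_of_nonneg_right (Finset.single_le_sum (f := c) (fun k _ => (hc k).le)
          (Finset.self_mem_range_succ _)) (hΨ.pos t ht).le

theorem exists_isKL (hb : UniformlyBounded r D) (hs : UniformlyStable r D)
    (ha : UniformlyAttractive r D) (hr : ∀ i, 0 < r i) (hD : ∀ i t, 0 ≤ t → 0 ≤ D i t) :
    ∃ β, IsKL β ∧ ∀ i t, 0 ≤ t → D i t ≤ β (r i) t := by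
  obtain ⟨C, Ψ, hC, hC0, hΨ, htail⟩ := hb.exists_tailSup_le_mul ha
  obtain ⟨G, hG, hle⟩ := exists_isKInfty_ge (g := fun δ => tailSup r D δ 0 * C δ)
    ((hb.monotone_tailSup 0).mul hC (hb.tailSup_nonneg · 0) hC0)
    (by simp only [tailSup_eq_zero hr, zero_mul]) (by
      refine (hb.tendsto_tailSup_nhdsGT hs 0).zero_mul_isBoundedUnder_le ?_
      refine isBoundedUnder_of_eventually_le (a := C 1) ?_
      filter_upwards [Ioc_mem_nhdsGT one_pos] with δ hδ
      simpa [abs_of_nonneg (hC0 δ)] using hC hδ.2)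
  refine ⟨_, hG.isKL_sqrt_mul hΨ, fun i t ht => Real.le_sqrt_of_sq_le ?_⟩
  have htail0 : D i t ≤ tailSup r D (r i) 0 :=
    (hb.le_tailSup le_rfl ht).trans (hb.antitone_tailSup _ ht)
  calc D i t ^ 2 = D i t * D i t := sq _
    _ ≤ tailSup r D (r i) 0 * (C (r i) * Ψ t) := mul_le_mul htail0
        ((hb.le_tailSup le_rfl ht).trans (htail _ t ht)) (hD i t ht) (hb.tailSup_nonneg _ _)
    _ = tailSup r D (r i) 0 * C (r i) * Ψ t := (mul_assoc _ _ _).symm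
    _ ≤ G (r i) * Ψ t := mul_le_mul_of_nonneg_right (hle _ (hr i).le) (hΨ.pos t ht).le

end UniformlyBounded

end ComparisonFunctions

/-! ### Concatenation of controlled arcs -/

section Steering

variable {m : ℕ} {E : Type*} [NormedAddCommGroup E] [NormedSpace ℝ E] {f : Fin m → E → E}
  {V W : Set E}

/-- `y` is an arc of the control system `y' = ∑ i, a_i f_i(y)` over the time interval `[a, b]`,
driven by `α` and contained in `V`. The equation is required for the right derivative, at every
time, so that arcs can be concatenated without exceptional null sets. -/
structure IsArc (f : Fin m → E → E) (V : Set E) (y : ℝ → E) (α : ℝ → Fin m → ℝ) (a b : ℝ) :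
    Prop where
  continuousOn : ContinuousOn y (Icc a b)
  mem : ∀ t ∈ Icc a b, y t ∈ V
  hasDerivWithinAt : ∀ t ∈ Ico a b, HasDerivWithinAt y (∑ i, α t i • f i (y t)) (Ici t) t

namespace IsArc

variable {y u : ℝ → E} {α γ : ℝ → Fin m → ℝ} {a b c : ℝ}

theorem mono (h : IsArc f V y α a b) (hVW : V ⊆ W) : IsArc f W y α a b :=
  ⟨h.continuousOn, fun t ht => hVW (h.mem t ht), h.hasDerivWithinAt⟩

theorem mono_right (h : IsArc f V y α a b) (hcb : c ≤ b) : IsArc f V y α a c :=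
  ⟨h.continuousOn.mono (Icc_subset_Icc_right hcb), fun t ht => h.mem t ⟨ht.1, ht.2.trans hcb⟩,
    fun t ht => h.hasDerivWithinAt t ⟨ht.1, ht.2.trans_le hcb⟩⟩

theorem congr (h : IsArc f V y α a b) (hu : EqOn u y (Icc a b)) (hγ : EqOn γ α (Ico a b)) :
    IsArc f V u γ a b where
  continuousOn := h.continuousOn.congr hu
  mem t ht := hu ht ▸ h.mem t ht
  hasDerivWithinAt t ht := by
    rw [hγ ht, hu (Ico_subset_Icc_self ht)]
    refine (h.hasDerivWithinAt t ht).congr_of_eventuallyEq ?_ (hu (Ico_subset_Icc_self ht))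
    filter_upwards [Icc_mem_nhdsGE ht.2] with r hr using hu ⟨ht.1.trans hr.1, hr.2⟩

theorem comp_sub (h : IsArc f V y α a b) (s : ℝ) :
    IsArc f V (fun t => y (t - s)) (fun t => α (t - s)) (a + s) (b + s) where
  continuousOn := h.continuousOn.comp (by fun_prop) fun _ ht =>
    ⟨le_sub_iff_add_le.2 ht.1, sub_le_iff_le_add.2 ht.2⟩
  mem _ ht := h.mem _ ⟨le_sub_iff_add_le.2 ht.1, sub_le_iff_le_add.2 ht.2⟩
  hasDerivWithinAt t ht := by
    have hy := h.hasDerivWithinAt (t - s) ⟨le_sub_iff_add_le.2 ht.1, sub_lt_iff_lt_add.2 ht.2⟩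
    simpa only [one_smul, Function.comp_def, id] using
      hy.scomp t ((hasDerivWithinAt_id t (Ici t)).sub_const s) fun r hr => sub_le_sub_right hr s

theorem append (h₁ : IsArc f V y α a b) (h₂ : IsArc f V y α b c) (hab : a ≤ b) (hbc : b ≤ c) :
    IsArc f V y α a c where
  continuousOn := by
    rw [← Icc_union_Icc_eq_Icc hab hbc]
    exact h₁.continuousOn.union_of_isClosed h₂.continuousOn isClosed_Icc isClosed_Icc
  mem t ht := (le_total t b).elim (fun h => h₁.mem t ⟨ht.1, h⟩) fun h => h₂.mem t ⟨h, ht.2⟩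
  hasDerivWithinAt t ht := (lt_or_ge t b).elim (fun h => h₁.hasDerivWithinAt t ⟨ht.1, h⟩)
    fun h => h₂.hasDerivWithinAt t ⟨h, ht.2⟩

theorem of_forall_succ {s : ℕ → ℝ} (hs : Monotone s)
    (h : ∀ k, IsArc f V y α (s k) (s (k + 1))) : ∀ k, IsArc f V y α (s 0) (s (k + 1))
  | 0 => h 0
  | k + 1 => (of_forall_succ hs h k).append (h (k + 1)) (hs (k + 1).zero_le)
      (hs (k + 1).le_succ)

end IsArc

/-- `x` can be steered to `z` in time `τ` inside `V` by a measurable control with values in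
`{±e_1, …, ±e_m}`. -/
def Steers (f : Fin m → E → E) (V : Set E) (x z : E) (τ : ℝ) : Prop :=
  ∃ (y : ℝ → E) (α : ℝ → Fin m → ℝ), y 0 = x ∧ y τ = z ∧ Measurable α ∧
    (∀ t, α t ∈ controlSet m) ∧ IsArc f V y α 0 τ

namespace Steers

variable {x z w : E} {τ σ : ℝ}

theorem mono (h : Steers f V x z τ) (hVW : V ⊆ W) : Steers f W x z τ := by
  obtain ⟨y, α, hx, hz, hα, hmem, harc⟩ := h
  exact ⟨y, α, hx, hz, hα, hmem, harc.mono hVW⟩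

theorem end_mem (h : Steers f V x z τ) (hτ : 0 ≤ τ) : z ∈ V := by
  obtain ⟨y, α, -, rfl, -, -, harc⟩ := h
  exact harc.mem τ ⟨hτ, le_rfl⟩

theorem trans (h₁ : Steers f V x z τ) (h₂ : Steers f V z w σ) (hτ : 0 ≤ τ) (hσ : 0 ≤ σ) :
    Steers f V x w (τ + σ) := by
  obtain ⟨y, α, rfl, hyz, hα, hαmem, hy⟩ := h₁
  obtain ⟨u, γ, huz, rfl, hγ, hγmem, hu⟩ := h₂
  let v : ℝ → E := fun t => if t < τ then y t else u (t - τ)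
  let δ : ℝ → Fin m → ℝ := fun t => if t < τ then α t else γ (t - τ)
  have hleft : EqOn v y (Icc 0 τ) := fun t ht => by
    rcases ht.2.lt_or_eq with hlt | rfl
    · exact if_pos hlt
    · simp only [v, lt_self_iff_false, if_false, sub_self, huz, hyz]
  have hright : EqOn v (fun t => u (t - τ)) (Ici τ) := fun t ht => if_neg (not_lt.2 ht)
  have harc₁ : IsArc f V v δ 0 τ := hy.congr hleft fun t ht => if_pos ht.2
  have harc₂ : IsArc f V v δ τ (τ + σ) := by
    have := (hu.comp_sub τ).congr (u := v) (γ := δ)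
      (hright.mono fun t ht => (zero_add τ) ▸ ht.1)
      fun t ht => if_neg (not_lt.2 ((zero_add τ) ▸ ht.1))
    rwa [zero_add, add_comm] at this
  refine ⟨v, δ, hleft ⟨le_rfl, hτ⟩, ?_, ?_, fun t => ?_,
    harc₁.append harc₂ hτ (le_add_of_nonneg_right hσ)⟩
  · exact (hright (le_add_of_nonneg_right hσ)).trans (congrArg u (add_sub_cancel_left τ σ))
  · exact Measurable.ite measurableSet_Iio hα (hγ.comp (measurable_id.sub_const τ))
  · by_cases ht : t < τ
    · simpa only [δ, ht, if_true] using hαmem t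
    · simpa only [δ, ht, if_false] using hγmem (t - τ)

end Steers

theorem exists_measurable_legIndex {s : ℕ → ℝ} (hs : Monotone s) :
    ∃ κ : ℝ → ℕ, Measurable κ ∧ ∀ k, ∀ t ∈ Ico (s k) (s (k + 1)), κ t = k := by
  refine exists_measurable_piecewise (fun k => Ico (s k) (s (k + 1))) (fun _ => measurableSet_Ico)
    (fun k _ => k) (fun _ => measurable_const) fun j k hjk t ht => ?_
  exact ((hs.pairwise_disjoint_on_Ico_succ hjk).le_bot ht).elim

theorem exists_arcs_of_steers {V : ℕ → Set E} {x : ℕ → E} {s : ℕ → ℝ} (hs0 : s 0 = 0)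
    (hs : StrictMono s) (h : ∀ k, Steers f (V k) (x k) (x (k + 1)) (s (k + 1) - s k)) (xbar : E) :
    ∃ (y : ℝ → E) (α : ℝ → Fin m → ℝ), y 0 = x 0 ∧ (∀ t, (∀ k, s k ≤ t) → y t = xbar) ∧
      Measurable α ∧ (∀ t, α t ∈ controlSet m) ∧ ∀ k, IsArc f (V k) y α (s k) (s (k + 1)) := by
  classical
  choose Y A hstart hend hA hAmem harc using h
  obtain ⟨κ, hκ, hκ_eq⟩ := exists_measurable_legIndex hs.monotone
  let y : ℝ → E := fun t => if ∀ k, s k ≤ t then xbar else Y (κ t) (t - s (κ t))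
  let α : ℝ → Fin m → ℝ := fun t => A (κ t) (t - s (κ t))
  have hy_Ico : ∀ k, EqOn y (fun t => Y k (t - s k)) (Ico (s k) (s (k + 1))) := fun k t ht => by
    have hlt : ¬ ∀ j, s j ≤ t := fun hall => (hall (k + 1)).not_gt ht.2
    simp only [y, hlt, if_false, hκ_eq k t ht]
  have hstart_Ico : ∀ k, s k ∈ Ico (s k) (s (k + 1)) := fun k => ⟨le_rfl, hs k.lt_succ_self⟩
  have hy : ∀ k, EqOn y (fun t => Y k (t - s k)) (Icc (s k) (s (k + 1))) := fun k t ht => by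
    rcases ht.2.lt_or_eq with hlt | rfl
    · exact hy_Ico k ⟨ht.1, hlt⟩
    · rw [hy_Ico (k + 1) (hstart_Ico (k + 1))]
      simp only [sub_self, hstart, hend]
  have hα : ∀ k, EqOn α (fun t => A k (t - s k)) (Ico (s k) (s (k + 1))) := fun k t ht => by
    simp only [α, hκ_eq k t ht]
  refine ⟨y, α, ?_, fun t ht => if_pos ht, ?_, fun t => hAmem _ _, fun k => ?_⟩
  · have := hy_Ico 0 (hstart_Ico 0)
    simpa only [hs0, sub_zero, hstart] using this
  · have hjoint : Measurable fun p : ℕ × ℝ => A p.1 (p.2 - s p.1) :=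
      measurable_from_prod_countable_right fun k => (hA k).comp (measurable_id.sub_const (s k))
    exact hjoint.comp (hκ.prodMk measurable_id)
  · have hshift := (harc k).comp_sub (s k)
    rw [zero_add, sub_add_cancel] at hshift
    exact hshift.congr (hy k) (hα k)

theorem norm_controlSet_apply_le {a : Fin m → ℝ} (ha : a ∈ controlSet m) (i : Fin m) :
    ‖a i‖ ≤ 1 := by
  obtain ⟨j, rfl | rfl⟩ := ha <;> by_cases h : i = j <;> simp [h]

namespace IsArc

variable {y : ℝ → E} {α : ℝ → Fin m → ℝ} {a b : ℝ}

theorem intervalIntegrable (h : IsArc f V y α a b) (hf : ∀ i, ContinuousOn (f i) V)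
    (hα : Measurable α) (hmem : ∀ t, α t ∈ controlSet m) (hab : a ≤ b) :
    IntervalIntegrable (fun t => ∑ i, α t i • f i (y t)) MeasureTheory.volume a b := by
  have hsum : ∀ i ∈ Finset.univ,
      IntervalIntegrable (fun t => α t i • f i (y t)) MeasureTheory.volume a b := fun i _ => by
    have hfy : IntervalIntegrable (fun t => f i (y t)) MeasureTheory.volume a b := by
      refine ContinuousOn.intervalIntegrable ?_
      rw [uIcc_of_le hab]
      exact (hf i).comp h.continuousOn h.mem
    rw [intervalIntegrable_iff] at hfy ⊢
    exact hfy.bdd_smul 1 ((measurable_pi_apply i).comp hα).aestronglyMeasurable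
      (.of_forall fun t => norm_controlSet_apply_le (hmem t) i)
  simpa only [Finset.sum_fn] using IntervalIntegrable.sum Finset.univ hsum

theorem eq_add_integral [CompleteSpace E] (h : IsArc f V y α a b)
    (hf : ∀ i, ContinuousOn (f i) V) (hα : Measurable α) (hmem : ∀ t, α t ∈ controlSet m)
    (hab : a ≤ b) : y b = y a + ∫ t in a..b, ∑ i, α t i • f i (y t) := by
  rw [intervalIntegral.integral_eq_sub_of_hasDeriv_right_of_le hab h.continuousOn
    (fun t ht => (h.hasDerivWithinAt t (Ioo_subset_Ico_self ht)).mono Ioi_subset_Ici_self)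
    (h.intervalIntegrable hf hα hmem hab), add_sub_cancel]

end IsArc

theorem isSolution_of_isArc {n : ℕ} {f : Fin m → State n → State n} {T : Set (State n)}
    {x : State n} {y : ℝ → State n} {α : ℝ → Fin m → ℝ} {S : EReal}
    (hf : ∀ i, ContinuousOn (f i) Tᶜ) (hS : 0 < S) (h0 : y 0 = x) (hα : Measurable α)
    (hmem : ∀ t, α t ∈ controlSet m)
    (harc : ∀ t : ℝ, 0 ≤ t → (t : EReal) < S → ∃ b > t, IsArc f Tᶜ y α 0 b) :
    IsSolution f T x y α S := by
  have harc_le : ∀ t : ℝ, 0 ≤ t → (t : EReal) < S → IsArc f Tᶜ y α 0 t := fun t ht htS => by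
    obtain ⟨b, hb, h⟩ := harc t ht htS
    exact h.mono_right hb.le
  refine ⟨hS, h0, fun t ht => ?_, fun t ht htS => (harc_le t ht htS).mem t ⟨ht, le_rfl⟩,
    fun t ht htS => (harc_le t ht htS).intervalIntegrable hf hα hmem ht,
    fun t ht htS => h0 ▸ (harc_le t ht htS).eq_add_integral hf hα hmem ht⟩
  obtain ⟨b, hb, h⟩ := harc t ht.1 ht.2
  refine (h.continuousOn t ⟨ht.1, hb.le⟩).mono_of_mem_nhdsWithin ?_
  filter_upwards [self_mem_nhdsWithin, mem_nhdsWithin_of_mem_nhds (Iio_mem_nhds hb)] with r hr hrb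
  exact ⟨hr.1, le_of_lt hrb⟩

end Steering

/-! ### Flows of bounded Lipschitz fields -/

theorem exists_nonexpansive_retraction {E : Type*} [NormedAddCommGroup E] [InnerProductSpace ℝ E]
    {C : Set E} (hne : C.Nonempty) (hcomp : IsComplete C) (hconv : Convex ℝ C) :
    ∃ P : E → E, LipschitzWith 1 P ∧ (∀ x, P x ∈ C) ∧ EqOn P id C := by
  have hex : ∀ x : E, ∃ v ∈ C, ∀ w ∈ C, inner ℝ (x - v) (w - v) ≤ 0 := fun x => by
    obtain ⟨v, hv, h⟩ := exists_norm_eq_iInf_of_complete_convex hne hcomp hconv x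
    exact ⟨v, hv, (norm_eq_iInf_iff_real_inner_le_zero hconv hv).1 h⟩
  choose P hPC hP using hex
  refine ⟨P, LipschitzWith.of_dist_le_mul fun x z => ?_, hPC, fun x hx => ?_⟩
  · have hsq : ‖P x - P z‖ * ‖P x - P z‖ ≤ ‖x - z‖ * ‖P x - P z‖ := by
      refine le_trans ?_ (real_inner_le_norm (x - z) (P x - P z))
      have hx := hP x (P z) (hPC z)
      have hz := hP z (P x) (hPC x)
      rw [← neg_sub (P x) (P z), inner_neg_right] at hx
      rw [← real_inner_self_eq_norm_mul_norm]
      have hsplit : inner ℝ (x - z) (P x - P z) = inner ℝ (x - P x) (P x - P z)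
          + inner ℝ (P x - P z) (P x - P z) - inner ℝ (z - P z) (P x - P z) := by
        rw [← inner_add_left, ← inner_sub_left]; congr 1; abel
      linarith
    rw [NNReal.coe_one, one_mul, dist_eq_norm, dist_eq_norm]
    rcases (norm_nonneg (P x - P z)).eq_or_lt with h0 | hpos
    · exact h0 ▸ norm_nonneg _
    · exact le_of_mul_le_mul_right hsq hpos
  · have h := hP x x hx
    rw [real_inner_self_eq_norm_sq] at h
    exact (sub_eq_zero.1 (norm_eq_zero.1 (pow_eq_zero_iff two_ne_zero |>.1
      (h.antisymm (sq_nonneg _))))).symm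

section Flow

variable {E : Type*} [NormedAddCommGroup E] {F : E → E} {K : NNReal} {M : ℝ}

/-- `F` is a globally bounded and Lipschitz vector field, with bound `M` and Lipschitz constant
`K`. -/
structure BoundedLipschitzWith (K : NNReal) (M : ℝ) (F : E → E) : Prop where
  lipschitz : LipschitzWith K F
  norm_le : ∀ x, ‖F x‖ ≤ M

namespace BoundedLipschitzWith

theorem bound_nonneg (hF : BoundedLipschitzWith K M F) : 0 ≤ M :=
  (norm_nonneg _).trans (hF.norm_le 0)

theorem neg (hF : BoundedLipschitzWith K M F) : BoundedLipschitzWith K M (-F) :=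
  ⟨hF.lipschitz.neg, fun x => (norm_neg (F x)).trans_le (hF.norm_le x)⟩

end BoundedLipschitzWith

variable [NormedSpace ℝ E] {φ : E → ℝ → E}

/-- `φ` is a flow of the vector field `F` on the time interval `[0,1]`. -/
structure IsUnitFlow (F : E → E) (φ : E → ℝ → E) : Prop where
  init : ∀ x, φ x 0 = x
  hasDerivWithinAt : ∀ x, ∀ t ∈ Icc (0 : ℝ) 1, HasDerivWithinAt (φ x) (F (φ x t)) (Icc 0 1) t

theorem BoundedLipschitzWith.exists_isUnitFlow [CompleteSpace E] (hF : BoundedLipschitzWith K M F) :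
    ∃ φ, IsUnitFlow F φ := by
  have hex : ∀ x : E, ∃ y : ℝ → E, y 0 = x ∧
      ∀ t ∈ Icc (0 : ℝ) 1, HasDerivWithinAt y (F (y t)) (Icc 0 1) t := fun x => by
    have hpl : IsPicardLindelof (fun _ => F) (tmin := 0) (tmax := 1) ⟨0, by simp⟩ x
        ⟨M, hF.bound_nonneg⟩ 0 ⟨M, hF.bound_nonneg⟩ K :=
      IsPicardLindelof.of_time_independent (fun z _ => hF.norm_le z) hF.lipschitz.lipschitzOnWith
        (by simp)
    exact hpl.exists_eq_forall_mem_Icc_hasDerivWithinAt₀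
  choose φ hinit hderiv using hex
  exact ⟨φ, hinit, hderiv⟩

namespace IsUnitFlow

theorem continuousOn (h : IsUnitFlow F φ) (x : E) : ContinuousOn (φ x) (Icc 0 1) :=
  fun t ht => (h.hasDerivWithinAt x t ht).continuousWithinAt

theorem hasDerivWithinAt_Ici (h : IsUnitFlow F φ) (x : E) {t : ℝ} (ht : t ∈ Ico (0 : ℝ) 1) :
    HasDerivWithinAt (φ x) (F (φ x t)) (Ici t) t :=
  (h.hasDerivWithinAt x t (Ico_subset_Icc_self ht)).mono_of_mem_nhdsWithin
    (mem_of_superset (Icc_mem_nhdsGE ht.2) (Icc_subset_Icc_left ht.1))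

theorem norm_sub_le (h : IsUnitFlow F φ) (hM : ∀ x, ‖F x‖ ≤ M) (x : E) {t : ℝ}
    (ht : t ∈ Icc (0 : ℝ) 1) : ‖φ x t - x‖ ≤ M * t := by
  have hmv := (convex_Icc (0 : ℝ) 1).norm_image_sub_le_of_norm_hasDerivWithin_le
    (h.hasDerivWithinAt x) (fun s _ => hM _) (left_mem_Icc.2 zero_le_one) ht
  rwa [h.init, sub_zero, Real.norm_of_nonneg ht.1] at hmv

theorem continuous_apply (h : IsUnitFlow F φ) (hF : LipschitzWith K F) {t : ℝ}
    (ht : t ∈ Icc (0 : ℝ) 1) : Continuous fun x => φ x t := by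
  refine (LipschitzWith.of_dist_le_mul (K := (Real.exp (K * t)).toNNReal) fun x z => ?_).continuous
  rw [Real.coe_toNNReal _ (Real.exp_pos _).le, mul_comm]
  have hgronwall := dist_le_of_trajectories_ODE (v := fun _ => F) (fun _ => hF)
    (h.continuousOn x) (fun s hs => h.hasDerivWithinAt_Ici x hs) (h.continuousOn z)
    (fun s hs => h.hasDerivWithinAt_Ici z hs) (δ := dist x z) (by rw [h.init, h.init]) t ht
  rwa [sub_zero] at hgronwall

theorem steers {m : ℕ} {f : Fin m → E → E} {V : Set E} {a : Fin m → ℝ} (h : IsUnitFlow F φ)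
    (ha : a ∈ controlSet m) (hF : ∀ v ∈ V, F v = ∑ i, a i • f i v) {x : E} {τ : ℝ} (hτ : τ ≤ 1)
    (hV : ∀ t ∈ Icc 0 τ, φ x t ∈ V) : Steers f V x (φ x τ) τ := by
  refine ⟨φ x, fun _ => a, h.init x, rfl, measurable_const, fun _ => ha,
    (h.continuousOn x).mono (Icc_subset_Icc_right hτ), hV, fun t ht => ?_⟩
  rw [← hF _ (hV t (Ico_subset_Icc_self ht))]
  exact h.hasDerivWithinAt_Ici x ⟨ht.1, ht.2.trans_le hτ⟩

theorem norm_displacement_sub_smul_le (h : IsUnitFlow F φ) (hF : BoundedLipschitzWith K M F)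
    (x x₀ : E) {t : ℝ} (ht : t ∈ Icc (0 : ℝ) 1) :
    ‖φ x t - x - t • F x₀‖ ≤ K * (‖x - x₀‖ + M * t) * t := by
  have hsub : Icc 0 t ⊆ Icc (0 : ℝ) 1 := Icc_subset_Icc_right ht.2
  have hderiv : ∀ s ∈ Icc 0 t, HasDerivWithinAt (fun s => φ x s - s • F x₀)
      (F (φ x s) - F x₀) (Icc 0 t) s := fun s hs => by
    simpa only [one_smul] using! ((h.hasDerivWithinAt x s (hsub hs)).mono hsub).sub
      ((hasDerivWithinAt_id s _).smul_const (F x₀))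
  have hbound : ∀ s ∈ Icc 0 t, ‖F (φ x s) - F x₀‖ ≤ K * (‖x - x₀‖ + M * t) := fun s hs =>
    calc ‖F (φ x s) - F x₀‖ ≤ K * ‖φ x s - x₀‖ := hF.lipschitz.norm_sub_le _ _
      _ ≤ K * (‖x - x₀‖ + ‖φ x s - x‖) := by
        gcongr
        rw [← sub_add_sub_cancel (φ x s) x x₀, add_comm ‖x - x₀‖]
        exact norm_add_le _ _
      _ ≤ K * (‖x - x₀‖ + M * t) := by
        gcongr
        exact (h.norm_sub_le hF.norm_le x (hsub hs)).trans
          (mul_le_mul_of_nonneg_left hs.2 hF.bound_nonneg)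
  have hmv := (convex_Icc (0 : ℝ) t).norm_image_sub_le_of_norm_hasDerivWithin_le hderiv hbound
    (left_mem_Icc.2 ht.1) (right_mem_Icc.2 ht.1)
  simpa only [zero_smul, sub_zero, h.init, Real.norm_of_nonneg ht.1, sub_right_comm] using hmv

theorem integral_eq_displacement [CompleteSpace E] (h : IsUnitFlow F φ) (hF : Continuous F)
    (x : E) {t : ℝ} (ht : t ∈ Icc (0 : ℝ) 1) : ∫ s in (0 : ℝ)..t, F (φ x s) = φ x t - x := by
  have hcont : ContinuousOn (φ x) (Icc 0 t) :=
    (h.continuousOn x).mono (Icc_subset_Icc_right ht.2)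
  rw [intervalIntegral.integral_eq_sub_of_hasDeriv_right_of_le ht.1 hcont (fun s hs =>
    (h.hasDerivWithinAt_Ici x ⟨hs.1.le, hs.2.trans_le ht.2⟩).mono Ioi_subset_Ici_self), h.init]
  refine ContinuousOn.intervalIntegrable ?_
  rw [uIcc_of_le ht.1]
  exact hF.comp_continuousOn hcont

theorem norm_displacement_sub_integral_le [CompleteSpace E] (h : IsUnitFlow F φ)
    (hF : BoundedLipschitzWith K M F) (x x₀ a : E) {t : ℝ} (ht : t ∈ Icc (0 : ℝ) 1) :
    ‖φ x t - x - ∫ s in (0 : ℝ)..t, F (a + s • F x₀)‖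
      ≤ K * (‖x - a‖ + K * (‖x - x₀‖ + M * t) * t) * t := by
  have hcont := hF.lipschitz.continuous
  have hint : IntervalIntegrable (fun s => F (φ x s)) MeasureTheory.volume 0 t := by
    refine ContinuousOn.intervalIntegrable ?_
    rw [uIcc_of_le ht.1]
    exact hcont.comp_continuousOn ((h.continuousOn x).mono (Icc_subset_Icc_right ht.2))
  have hbound : ∀ s ∈ uIoc 0 t, ‖F (φ x s) - F (a + s • F x₀)‖
      ≤ K * (‖x - a‖ + K * (‖x - x₀‖ + M * t) * t) := fun s hs => by
    rw [uIoc_of_le ht.1] at hs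
    have hM := hF.bound_nonneg
    have ht0 := ht.1
    calc ‖F (φ x s) - F (a + s • F x₀)‖ ≤ K * ‖φ x s - (a + s • F x₀)‖ :=
          hF.lipschitz.norm_sub_le _ _
      _ = K * ‖(x - a) + (φ x s - x - s • F x₀)‖ := by congr 2; abel
      _ ≤ K * (‖x - a‖ + ‖φ x s - x - s • F x₀‖) := by gcongr; exact norm_add_le _ _
      _ ≤ K * (‖x - a‖ + K * (‖x - x₀‖ + M * s) * s) := by
        gcongr
        exact h.norm_displacement_sub_smul_le hF x x₀ ⟨hs.1.le, hs.2.trans ht.2⟩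
      _ ≤ _ := by
        have hs0 := hs.1.le
        gcongr <;> exact hs.2
  have hline : IntervalIntegrable (fun s => F (a + s • F x₀)) MeasureTheory.volume 0 t :=
    (hcont.comp (by fun_prop : Continuous fun s : ℝ => a + s • F x₀)).intervalIntegrable _ _
  rw [← h.integral_eq_displacement hcont x ht, ← intervalIntegral.integral_sub hint hline]
  simpa only [sub_zero, abs_of_nonneg ht.1] using
    intervalIntegral.norm_integral_le_of_norm_le_const hbound

end IsUnitFlow

end Flow

/-! ### Circulation of Lipschitz fields -/

section Circulation

open MeasureTheory

variable {E H : Type*} [NormedAddCommGroup E] [NormedSpace ℝ E] [NormedAddCommGroup H]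
  [NormedSpace ℝ H]

/-- The circulation, along the boundary of the parallelogram with vertex `z` and sides `t • a`,
`t • b`, of the one-form taking the value `u` on `a` and `v` on `b`. -/
noncomputable def circulation (u v : E → H) (z a b : E) (t : ℝ) : H :=
  (∫ r in (0 : ℝ)..t, (v (z + t • a + r • b) - v (z + r • b)))
    - ∫ s in (0 : ℝ)..t, (u (z + t • b + s • a) - u (z + s • a))

theorem continuous_circulation {u v : E → H} (hu : Continuous u) (hv : Continuous v) (a b : E)
    (t : ℝ) : Continuous fun z => circulation u v z a b t := by
  have hside : ∀ w : E → H, Continuous w → ∀ c d : E,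
      Continuous fun z => ∫ r in (0 : ℝ)..t, (w (z + t • c + r • d) - w (z + r • d)) :=
    fun w hw c d => intervalIntegral.continuous_parametric_intervalIntegral_of_continuous'
      (by unfold Function.uncurry; fun_prop) _ _
  exact (hside v hv a b).sub (hside u hu b a)

theorem circulation_eq {u v : E → H} (hu : Continuous u) (hv : Continuous v) (z a b : E)
    (t : ℝ) : circulation u v z a b t
      = (∫ s in (0 : ℝ)..t, u (z + s • a)) + (∫ r in (0 : ℝ)..t, v (z + t • a + r • b))
        - (∫ s in (0 : ℝ)..t, u (z + t • b + s • a)) - ∫ r in (0 : ℝ)..t, v (z + r • b) := by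
  rw [circulation, intervalIntegral.integral_sub, intervalIntegral.integral_sub]
  · abel
  all_goals exact Continuous.intervalIntegrable (by fun_prop) _ _

theorem map_circulation [CompleteSpace H] {u v : E → H} (hu : Continuous u)
    (hv : Continuous v) (ℓ : H →L[ℝ] ℝ) (z a b : E) (t : ℝ) :
    ℓ (circulation u v z a b t) = circulation (ℓ ∘ u) (ℓ ∘ v) z a b t := by
  have hside : ∀ w : E → H, Continuous w → ∀ c d : E,
      ℓ (∫ r in (0 : ℝ)..t, (w (z + t • c + r • d) - w (z + r • d)))
        = ∫ r in (0 : ℝ)..t, (ℓ (w (z + t • c + r • d)) - ℓ (w (z + r • d))) := fun w hw c d => by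
    have hint : IntervalIntegrable (fun r : ℝ => w (z + t • c + r • d) - w (z + r • d))
        volume 0 t := Continuous.intervalIntegrable (by fun_prop) _ _
    simpa only [map_sub] using (ℓ.intervalIntegral_comp_comm hint).symm
  rw [circulation, map_sub, hside v hv, hside u hu]
  rfl

theorem integral_fderiv_line {u : E → ℝ} {K : NNReal} (hu : LipschitzWith K u) (z a : E) {t : ℝ}
    (ht : 0 ≤ t) (hd : ∀ᵐ s ∂volume.restrict (Ioc 0 t), DifferentiableAt ℝ u (z + s • a)) :
    ∫ s in Ioc 0 t, fderiv ℝ u (z + s • a) a = u (z + t • a) - u z := by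
  have hlip : LipschitzWith (K * ‖a‖₊) fun s : ℝ => u (z + s • a) := by
    refine hu.comp (LipschitzWith.of_dist_le_mul fun s r => ?_)
    rw [dist_add_left, dist_eq_norm, ← sub_smul, norm_smul, mul_comm, Real.dist_eq]
    rfl
  have hftc := (hlip.lipschitzOnWith (s := uIcc 0 t)).absolutelyContinuousOnInterval
    |>.integral_deriv_eq_sub
  rw [zero_smul, add_zero, intervalIntegral.integral_of_le ht] at hftc
  rw [← hftc]
  refine integral_congr_ae ?_
  filter_upwards [hd] with s hs
  have hline : HasDerivAt (fun s : ℝ => z + s • a) a s := by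
    simpa only [one_smul] using! ((hasDerivAt_id s).smul_const a).const_add z
  exact (hs.hasFDerivAt.comp_hasDerivAt s hline).deriv.symm

variable [MeasurableSpace E] [BorelSpace E]

theorem ae_ae_add_smul_add_smul [SecondCountableTopology E] {μ : Measure E} [SFinite μ]
    [μ.IsAddRightInvariant] {Q : E → Prop} (hQ : ∀ᵐ x ∂μ, Q x) (a b : E) :
    ∀ᵐ z ∂μ, ∀ᵐ q : ℝ × ℝ, Q (z + q.1 • a + q.2 • b) := by
  have hmeas : Measurable fun w : E × ℝ × ℝ => w.1 + (w.2.1 • a + w.2.2 • b) := by fun_prop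
  have hqmp := QuasiMeasurePreserving.prod_of_left (μ := μ) (ν := volume) (τ := μ) hmeas
    (Eventually.of_forall fun q =>
      (measurePreserving_add_right μ (q.1 • a + q.2 • b)).quasiMeasurePreserving)
  simpa only [add_assoc] using Measure.ae_ae_of_ae_prod (hqmp.ae hQ)

theorem integrable_fderiv_comp {α : Type*} [MeasurableSpace α] {ν : Measure α}
    [IsFiniteMeasure ν] {u : E → ℝ} {K : NNReal} (hu : LipschitzWith K u) {g : α → E}
    (hg : Measurable g) (e : E) : Integrable (fun q => fderiv ℝ u (g q) e) ν :=
  Integrable.of_bound (C := K * ‖e‖)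
    ((measurable_fderiv_apply_const ℝ u e).comp hg).aestronglyMeasurable
    (Eventually.of_forall fun _ => (ContinuousLinearMap.le_opNorm _ _).trans
      (mul_le_mul_of_nonneg_right (norm_fderiv_le_of_lipschitz ℝ hu) (norm_nonneg _)))

theorem integral_sub_eq_setIntegral_fderiv [SecondCountableTopology E] {u : E → ℝ} {K : NNReal}
    (hu : LipschitzWith K u) {z a b : E} {t : ℝ} (ht : 0 ≤ t)
    (hd : ∀ᵐ q : ℝ × ℝ, DifferentiableAt ℝ u (z + q.1 • a + q.2 • b)) :
    ∫ r in (0 : ℝ)..t, (u (z + t • a + r • b) - u (z + r • b))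
      = ∫ q in Ioc 0 t ×ˢ Ioc 0 t, fderiv ℝ u (z + q.1 • a + q.2 • b) a := by
  have hd' : ∀ᵐ r ∂volume.restrict (Ioc 0 t), ∀ᵐ s ∂volume.restrict (Ioc 0 t),
      DifferentiableAt ℝ u (z + s • a + r • b) := by
    refine Measure.ae_ae_of_ae_prod (Measure.measurePreserving_swap.quasiMeasurePreserving.ae
      (p := fun q : ℝ × ℝ => DifferentiableAt ℝ u (z + q.1 • a + q.2 • b)) ?_)
    rw [Measure.prod_restrict]
    exact ae_restrict_of_ae hd
  rw [Measure.volume_eq_prod, ← Measure.prod_restrict, integral_prod_symm _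
    (integrable_fderiv_comp hu (by fun_prop) a), intervalIntegral.integral_of_le ht]
  refine integral_congr_ae ?_
  filter_upwards [hd'] with r hr
  simp only [add_right_comm z _ (r • b)] at hr ⊢
  exact (integral_fderiv_line hu (z + r • b) a ht hr).symm

theorem circulation_le_of_ae [SecondCountableTopology E] {u v : E → ℝ} {K : NNReal}
    (hu : LipschitzWith K u) (hv : LipschitzWith K v) {z a b : E} {c t : ℝ} (ht : 0 ≤ t)
    (hud : ∀ᵐ q : ℝ × ℝ, DifferentiableAt ℝ u (z + q.1 • a + q.2 • b))
    (hvd : ∀ᵐ q : ℝ × ℝ, DifferentiableAt ℝ v (z + q.1 • a + q.2 • b))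
    (hcurl : ∀ᵐ q : ℝ × ℝ, q ∈ Ioc 0 t ×ˢ Ioc 0 t →
      fderiv ℝ v (z + q.1 • a + q.2 • b) a - fderiv ℝ u (z + q.1 • a + q.2 • b) b ≤ c) :
    circulation u v z a b t ≤ c * t ^ 2 := by
  have hfin : IsFiniteMeasure (volume.restrict (Ioc 0 t ×ˢ Ioc 0 t)) := by
    rw [Measure.volume_eq_prod, ← Measure.prod_restrict]; infer_instance
  have hint : ∀ w : E → ℝ, LipschitzWith K w → ∀ e, IntegrableOn
      (fun q : ℝ × ℝ => fderiv ℝ w (z + q.1 • a + q.2 • b) e) (Ioc 0 t ×ˢ Ioc 0 t) :=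
    fun w hw e => integrable_fderiv_comp hw (by fun_prop) e
  have hswap : ∫ s in (0 : ℝ)..t, (u (z + t • b + s • a) - u (z + s • a))
      = ∫ q in Ioc 0 t ×ˢ Ioc 0 t, fderiv ℝ u (z + q.1 • a + q.2 • b) b := by
    have hud' := Measure.measurePreserving_swap.quasiMeasurePreserving.ae
      (hud.mono fun q hq => by rwa [add_right_comm] at hq)
    rw [integral_sub_eq_setIntegral_fderiv hu ht hud', Measure.volume_eq_prod,
      ← Measure.prod_restrict, ← integral_prod_swap]
    simp only [Prod.fst_swap, Prod.snd_swap, add_right_comm]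
  calc circulation u v z a b t
      = ∫ q in Ioc 0 t ×ˢ Ioc 0 t, (fderiv ℝ v (z + q.1 • a + q.2 • b) a
          - fderiv ℝ u (z + q.1 • a + q.2 • b) b) := by
        rw [circulation, integral_sub_eq_setIntegral_fderiv hv ht hvd, hswap,
          integral_sub (hint v hv a) (hint u hu b)]
    _ ≤ ∫ _ in Ioc 0 t ×ˢ Ioc (0 : ℝ) t, c :=
        setIntegral_mono_on_ae ((hint v hv a).sub (hint u hu b)) (integrable_const c)
          (measurableSet_Ioc.prod measurableSet_Ioc) hcurl
    _ = c * t ^ 2 := by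
        rw [setIntegral_const, Measure.volume_eq_prod, measureReal_prod_prod,
          Real.volume_real_Ioc_of_le ht, sub_zero, smul_eq_mul]
        ring

end Circulation

section Green

open MeasureTheory

variable {E H : Type*} [NormedAddCommGroup E] [NormedSpace ℝ E] [FiniteDimensional ℝ E]
  [NormedAddCommGroup H] [NormedSpace ℝ H]

theorem norm_smul_add_smul_le {E : Type*} [SeminormedAddCommGroup E] [NormedSpace ℝ E] (a b : E)
    {s r t : ℝ} (hs : s ∈ Icc 0 t) (hr : r ∈ Icc 0 t) :
    ‖s • a + r • b‖ ≤ t * (‖a‖ + ‖b‖) := by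
  refine (norm_add_le _ _).trans ?_
  rw [norm_smul, norm_smul, Real.norm_of_nonneg hs.1, Real.norm_of_nonneg hr.1, mul_add]
  have := hs.2
  have := hr.2
  gcongr

theorem circulation_le_of_ae_ball [MeasurableSpace E] [BorelSpace E] {μ : Measure E}
    [μ.IsAddHaarMeasure] {u v : E → ℝ} {K : NNReal} (hu : LipschitzWith K u)
    (hv : LipschitzWith K v) {x₀ a b : E} {c δ t : ℝ} (ht : 0 ≤ t) (hδ : t * (‖a‖ + ‖b‖) < δ)
    (hcurl : ∀ᵐ x ∂μ, x ∈ Metric.ball x₀ δ → fderiv ℝ v x a - fderiv ℝ u x b ≤ c) :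
    circulation u v x₀ a b t ≤ c * t ^ 2 := by
  by_contra! hlt
  have hdense := Measure.dense_of_ae (((ae_ae_add_smul_add_smul hu.ae_differentiableAt a b).and
    (ae_ae_add_smul_add_smul hv.ae_differentiableAt a b)).and (ae_ae_add_smul_add_smul hcurl a b))
  obtain ⟨z, ⟨hz, hzball⟩, ⟨hzu, hzv⟩, hzc⟩ := hdense.inter_open_nonempty
    ({z | c * t ^ 2 < circulation u v z a b t} ∩ Metric.ball x₀ (δ - t * (‖a‖ + ‖b‖)))
    ((isOpen_lt continuous_const (continuous_circulation hu.continuous hv.continuous a b t)).inter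
      Metric.isOpen_ball) ⟨x₀, hlt, Metric.mem_ball_self (sub_pos.2 hδ)⟩
  refine (mem_ofPred_eq.mp hz).not_ge (circulation_le_of_ae hu hv ht hzu hzv ?_)
  filter_upwards [hzc] with q hqc hq
  refine hqc ?_
  rw [mem_ball_iff_norm] at hzball ⊢
  have hstep := norm_smul_add_smul_le a b (Ioc_subset_Icc_self hq.1) (Ioc_subset_Icc_self hq.2)
  calc ‖z + q.1 • a + q.2 • b - x₀‖ = ‖(z - x₀) + (q.1 • a + q.2 • b)‖ := by congr 1; abel
    _ ≤ ‖z - x₀‖ + ‖q.1 • a + q.2 • b‖ := norm_add_le _ _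
    _ < δ := by linarith

theorem eventually_apply_circulation_le [FiniteDimensional ℝ H] {u v : E → H} {K : NNReal}
    (hu : LipschitzWith K u) (hv : LipschitzWith K v) (ℓ : H →L[ℝ] ℝ) {x₀ a b : E} {c : ℝ}
    (hcurl : ∀ᶠ x in 𝓝 x₀, DifferentiableAt ℝ u x → DifferentiableAt ℝ v x →
      ℓ (fderiv ℝ v x a - fderiv ℝ u x b) ≤ c) :
    ∀ᶠ t in 𝓝[>] (0 : ℝ), ℓ (circulation u v x₀ a b t) ≤ c * t ^ 2 := by
  have := FiniteDimensional.complete ℝ H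
  borelize E
  obtain ⟨δ, hδ, hball⟩ := Metric.eventually_nhds_iff_ball.1 hcurl
  have hae : ∀ᵐ x ∂(Measure.addHaar : Measure E), x ∈ Metric.ball x₀ δ →
      fderiv ℝ (ℓ ∘ v) x a - fderiv ℝ (ℓ ∘ u) x b ≤ c := by
    filter_upwards [hu.ae_differentiableAt, hv.ae_differentiableAt] with x hux hvx hx
    rw [fderiv_comp x ℓ.differentiableAt hvx, fderiv_comp x ℓ.differentiableAt hux, ℓ.fderiv,
      ℓ.fderiv]
    simpa only [ContinuousLinearMap.comp_apply, map_sub] using hball x hx hux hvx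
  have hsmall : ∀ᶠ t in 𝓝[>] (0 : ℝ), t * (‖a‖ + ‖b‖) < δ := by
    have hlim : Tendsto (fun t : ℝ => t * (‖a‖ + ‖b‖)) (𝓝 0) (𝓝 (0 * (‖a‖ + ‖b‖))) :=
      tendsto_id.mul_const _
    rw [zero_mul] at hlim
    exact nhdsWithin_le_nhds (hlim.eventually_lt_const hδ)
  filter_upwards [hsmall, self_mem_nhdsWithin] with t ht ht0
  rw [map_circulation hu.continuous hv.continuous]
  exact circulation_le_of_ae_ball (ℓ.lipschitz.comp hu) (ℓ.lipschitz.comp hv) (le_of_lt ht0) ht hae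

end Green

/-! ### Commutators and limiting brackets -/

section Commutator

open MeasureTheory

/-- The end point of the four-leg motion `φ`, `ψ`, `φ'`, `ψ'`, each leg of duration `t`. If these
are the flows of `F`, `G`, `-F` and `-G`, it is the commutator of the flows of `F` and `G`. -/
def fourLegs {E : Type*} (φ ψ φ' ψ' : E → ℝ → E) (t : ℝ) (x : E) : E :=
  ψ' (φ' (ψ (φ x t) t) t) t

theorem integral_neg_comp_reverse {E H : Type*} [NormedAddCommGroup E] [NormedSpace ℝ E]
    [NormedAddCommGroup H] [NormedSpace ℝ H] (u : E → H) (z a : E) (t : ℝ) :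
    ∫ s in (0 : ℝ)..t, -u (z + t • a + s • -a) = -∫ s in (0 : ℝ)..t, u (z + s • a) := by
  have hrev := intervalIntegral.integral_comp_sub_left (a := 0) (b := t)
    (fun s => u (z + s • a)) t
  rw [sub_self, sub_zero] at hrev
  rw [intervalIntegral.integral_neg, ← hrev]
  congr! 4 with s
  rw [sub_smul, smul_neg, add_assoc, sub_eq_add_neg]

variable {E : Type*} [NormedAddCommGroup E] [NormedSpace ℝ E] {F G : E → E} {K : NNReal} {M : ℝ}
  {φ ψ φ' ψ' : E → ℝ → E} {x₀ : E} {t : ℝ}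

theorem IsUnitFlow.norm_sub_le_add (h : IsUnitFlow F φ) (hM : ∀ x, ‖F x‖ ≤ M) {x : E} {k : ℝ}
    (hx : ‖x - x₀‖ ≤ k * (M * t)) (ht : t ∈ Icc (0 : ℝ) 1) :
    ‖φ x t - x₀‖ ≤ (k + 1) * (M * t) := by
  rw [← sub_add_sub_cancel (φ x t) x x₀]
  linarith [norm_add_le (φ x t - x) (x - x₀), h.norm_sub_le hM x ht]

theorem IsUnitFlow.norm_sub_vertex_le (h : IsUnitFlow F φ) (hF : BoundedLipschitzWith K M F)
    {x a : E} {k e : ℝ} (hx : ‖x - x₀‖ ≤ k * (M * t)) (ha : ‖x - a‖ ≤ e * (K * M * t ^ 2))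
    (ht : t ∈ Icc (0 : ℝ) 1) :
    ‖φ x t - (a + t • F x₀)‖ ≤ (e + (k + 1)) * (K * M * t ^ 2) := by
  have ht0 := ht.1
  have hdisp := h.norm_displacement_sub_smul_le hF x x₀ ht
  calc ‖φ x t - (a + t • F x₀)‖ = ‖(x - a) + (φ x t - x - t • F x₀)‖ := by congr 1; abel
    _ ≤ ‖x - a‖ + ‖φ x t - x - t • F x₀‖ := norm_add_le _ _
    _ ≤ e * (K * M * t ^ 2) + K * (k * (M * t) + M * t) * t := by
      refine add_le_add ha (hdisp.trans ?_)
      gcongr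
    _ = (e + (k + 1)) * (K * M * t ^ 2) := by ring

theorem IsUnitFlow.norm_leg_sub_integral_le [CompleteSpace E] (h : IsUnitFlow F φ)
    (hF : BoundedLipschitzWith K M F) {x a : E} {k e : ℝ} (hx : ‖x - x₀‖ ≤ k * (M * t))
    (ha : ‖x - a‖ ≤ e * (K * M * t ^ 2)) (ht : t ∈ Icc (0 : ℝ) 1) :
    ‖φ x t - x - ∫ s in (0 : ℝ)..t, F (a + s • F x₀)‖ ≤ (e + (k + 1)) * (K ^ 2 * M * t ^ 3) := by
  have ht0 := ht.1
  calc ‖φ x t - x - ∫ s in (0 : ℝ)..t, F (a + s • F x₀)‖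
      ≤ K * (‖x - a‖ + K * (‖x - x₀‖ + M * t) * t) * t :=
        h.norm_displacement_sub_integral_le hF x x₀ a ht
    _ ≤ K * (e * (K * M * t ^ 2) + K * (k * (M * t) + M * t) * t) * t := by gcongr
    _ = (e + (k + 1)) * (K ^ 2 * M * t ^ 3) := by ring

theorem norm_leg_sub_le (hF : BoundedLipschitzWith K M F) (hG : BoundedLipschitzWith K M G)
    (hφ : IsUnitFlow F φ) (hψ : IsUnitFlow G ψ) (hφ' : IsUnitFlow (-F) φ') (x₀ : E)
    (ht : t ∈ Icc (0 : ℝ) 1) :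
    ‖φ x₀ t - x₀‖ ≤ 1 * (M * t) ∧ ‖ψ (φ x₀ t) t - x₀‖ ≤ 2 * (M * t) ∧
      ‖φ' (ψ (φ x₀ t) t) t - x₀‖ ≤ 3 * (M * t) := by
  have h₁ := (hφ.norm_sub_le_add hF.norm_le (x := x₀) (x₀ := x₀) (k := 0) (by simp) ht).trans_eq
    (show _ = 1 * (M * t) by ring)
  have h₂ := (hψ.norm_sub_le_add hG.norm_le h₁ ht).trans_eq (show _ = 2 * (M * t) by ring)
  have h₃ := (hφ'.norm_sub_le_add hF.neg.norm_le h₂ ht).trans_eq (show _ = 3 * (M * t) by ring)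
  exact ⟨h₁, h₂, h₃⟩

theorem norm_leg_sub_vertex_le (hF : BoundedLipschitzWith K M F) (hG : BoundedLipschitzWith K M G)
    (hφ : IsUnitFlow F φ) (hψ : IsUnitFlow G ψ) (hφ' : IsUnitFlow (-F) φ') (x₀ : E)
    (ht : t ∈ Icc (0 : ℝ) 1) :
    ‖φ x₀ t - (x₀ + t • F x₀)‖ ≤ 1 * (K * M * t ^ 2) ∧
      ‖ψ (φ x₀ t) t - (x₀ + t • G x₀ + t • F x₀)‖ ≤ 3 * (K * M * t ^ 2) ∧
      ‖φ' (ψ (φ x₀ t) t) t - (x₀ + t • G x₀)‖ ≤ 6 * (K * M * t ^ 2) := by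
  obtain ⟨d₁, d₂, -⟩ := norm_leg_sub_le hF hG hφ hψ hφ' x₀ ht
  have h₁ := (hφ.norm_sub_vertex_le hF (x := x₀) (x₀ := x₀) (a := x₀) (k := 0) (e := 0)
    (by simp) (by simp) ht).trans_eq (show _ = 1 * (K * M * t ^ 2) by ring)
  have h₂ := (hψ.norm_sub_vertex_le hG d₁ h₁ ht).trans_eq (show _ = 3 * (K * M * t ^ 2) by ring)
  rw [add_right_comm] at h₂
  have h₃ := (hφ'.norm_sub_vertex_le hF.neg d₂ h₂ ht).trans_eq
    (show _ = 6 * (K * M * t ^ 2) by ring)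
  rw [Pi.neg_apply, smul_neg, add_neg_cancel_right] at h₃
  exact ⟨h₁, h₂, h₃⟩

theorem norm_fourLegs_sub_le (hF : BoundedLipschitzWith K M F) (hG : BoundedLipschitzWith K M G)
    (hφ : IsUnitFlow F φ) (hψ : IsUnitFlow G ψ) (hφ' : IsUnitFlow (-F) φ')
    (hψ' : IsUnitFlow (-G) ψ') (x₀ : E) (ht : t ∈ Icc (0 : ℝ) 1) :
    ‖fourLegs φ ψ φ' ψ' t x₀ - x₀‖ ≤ 10 * (K * M * t ^ 2) := by
  obtain ⟨-, -, d₃⟩ := norm_leg_sub_le hF hG hφ hψ hφ' x₀ ht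
  obtain ⟨-, -, e₃⟩ := norm_leg_sub_vertex_le hF hG hφ hψ hφ' x₀ ht
  have h₄ := (hψ'.norm_sub_vertex_le hG.neg d₃ e₃ ht).trans_eq
    (show _ = 10 * (K * M * t ^ 2) by ring)
  rwa [Pi.neg_apply, smul_neg, add_neg_cancel_right] at h₄

theorem norm_fourLegs_sub_circulation_le [CompleteSpace E] (hF : BoundedLipschitzWith K M F)
    (hG : BoundedLipschitzWith K M G) (hφ : IsUnitFlow F φ) (hψ : IsUnitFlow G ψ)
    (hφ' : IsUnitFlow (-F) φ') (hψ' : IsUnitFlow (-G) ψ') (x₀ : E) (ht : t ∈ Icc (0 : ℝ) 1) :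
    ‖fourLegs φ ψ φ' ψ' t x₀ - x₀ - circulation F G x₀ (F x₀) (G x₀) t‖
      ≤ 20 * (K ^ 2 * M * t ^ 3) := by
  obtain ⟨d₁, d₂, d₃⟩ := norm_leg_sub_le hF hG hφ hψ hφ' x₀ ht
  obtain ⟨e₁, e₂, e₃⟩ := norm_leg_sub_vertex_le hF hG hφ hψ hφ' x₀ ht
  have g₁ := hφ.norm_leg_sub_integral_le hF (x := x₀) (x₀ := x₀) (a := x₀) (k := 0) (e := 0)
    (by simp) (by simp) ht
  have g₂ := hψ.norm_leg_sub_integral_le hG d₁ e₁ ht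
  have g₃ := hφ'.norm_leg_sub_integral_le hF.neg d₂ e₂ ht
  have g₄ := hψ'.norm_leg_sub_integral_le hG.neg d₃ e₃ ht
  simp only [Pi.neg_apply, integral_neg_comp_reverse, sub_neg_eq_add] at g₃ g₄
  rw [circulation_eq hF.lipschitz.continuous hG.lipschitz.continuous]
  refine le_trans (le_of_eq ?_) ((norm_add₄_le.trans (add_le_add (add_le_add (add_le_add g₁ g₂) g₃)
    g₄)).trans_eq (show _ = 20 * (K ^ 2 * M * t ^ 3) by ring))
  rw [fourLegs]
  congr 1
  abel

end Commutator

section Bracket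

variable {E : Type*} [NormedAddCommGroup E] [InnerProductSpace ℝ E] {F G : E → E} {K : NNReal}
  {M c c' : ℝ} {x₀ p : E}

theorem eventually_inner_curl_le (hF : LipschitzWith K F) (hG : LipschitzWith K G) (hc : c < c')
    (hbr : ∀ᶠ x in 𝓝 x₀, DifferentiableAt ℝ F x → DifferentiableAt ℝ G x →
      inner ℝ p (VectorField.lieBracket ℝ F G x) ≤ c) :
    ∀ᶠ x in 𝓝 x₀, DifferentiableAt ℝ F x → DifferentiableAt ℝ G x →
      inner ℝ p (fderiv ℝ G x (F x₀) - fderiv ℝ F x (G x₀)) ≤ c' := by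
  have herr : Tendsto (fun x => ‖p‖ * (2 * (K * (K * ‖x₀ - x‖)))) (𝓝 x₀) (𝓝 0) := by
    refine Continuous.tendsto' (by fun_prop) _ _ (by simp)
  have hstep : ∀ {A B : E → E}, LipschitzWith K A → LipschitzWith K B → ∀ x,
      ‖fderiv ℝ A x (B x₀ - B x)‖ ≤ K * (K * ‖x₀ - x‖) := fun hA hB x =>
    (ContinuousLinearMap.le_opNorm _ _).trans (mul_le_mul (norm_fderiv_le_of_lipschitz ℝ hA)
      (hB.norm_sub_le _ _) (norm_nonneg _) K.coe_nonneg)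
  filter_upwards [hbr, herr.eventually_lt_const (sub_pos.2 hc)] with x hx hsmall hFx hGx
  calc inner ℝ p (fderiv ℝ G x (F x₀) - fderiv ℝ F x (G x₀))
      = inner ℝ p (VectorField.lieBracket ℝ F G x)
        + inner ℝ p (fderiv ℝ G x (F x₀ - F x) - fderiv ℝ F x (G x₀ - G x)) := by
        rw [← inner_add_right, VectorField.lieBracket]
        congr 1
        simp only [map_sub]
        abel
    _ ≤ c + ‖p‖ * (2 * (K * (K * ‖x₀ - x‖))) := by
        refine add_le_add (hx hFx hGx) ((real_inner_le_norm _ _).trans ?_)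
        gcongr
        exact (norm_sub_le _ _).trans (by linarith [hstep hG hF x, hstep hF hG x])
    _ ≤ c' := by linarith

theorem eventually_inner_fourLegs_le [FiniteDimensional ℝ E] (hF : BoundedLipschitzWith K M F)
    (hG : BoundedLipschitzWith K M G) {φ ψ φ' ψ' : E → ℝ → E} (hφ : IsUnitFlow F φ)
    (hψ : IsUnitFlow G ψ) (hφ' : IsUnitFlow (-F) φ') (hψ' : IsUnitFlow (-G) ψ') (hc : c < c')
    (hbr : ∀ᶠ x in 𝓝 x₀, DifferentiableAt ℝ F x → DifferentiableAt ℝ G x →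
      inner ℝ p (VectorField.lieBracket ℝ F G x) ≤ c) :
    ∀ᶠ t in 𝓝[>] (0 : ℝ), inner ℝ p (fourLegs φ ψ φ' ψ' t x₀ - x₀) ≤ c' * t ^ 2 := by
  have := FiniteDimensional.complete ℝ E
  obtain ⟨d, hcd, hdc⟩ := exists_between hc
  have hcirc := eventually_apply_circulation_le hF.lipschitz hG.lipschitz (innerSL ℝ p)
    (eventually_inner_curl_le hF.lipschitz hG.lipschitz hcd hbr)
  have herr : Tendsto (fun t : ℝ => ‖p‖ * (20 * (K ^ 2 * M * t))) (𝓝 0) (𝓝 0) :=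
    Continuous.tendsto' (by fun_prop) _ _ (by simp)
  filter_upwards [hcirc, nhdsWithin_le_nhds (herr.eventually_lt_const (sub_pos.2 hdc)),
    Ioc_mem_nhdsGT zero_lt_one] with t hct hsmall ht
  set W := circulation F G x₀ (F x₀) (G x₀) t
  have hdisp := norm_fourLegs_sub_circulation_le hF hG hφ hψ hφ' hψ' x₀ (Ioc_subset_Icc_self ht)
  calc inner ℝ p (fourLegs φ ψ φ' ψ' t x₀ - x₀)
      = inner ℝ p W + inner ℝ p (fourLegs φ ψ φ' ψ' t x₀ - x₀ - W) := by
        rw [← inner_add_right, add_sub_cancel]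
    _ ≤ d * t ^ 2 + ‖p‖ * (20 * (K ^ 2 * M * t ^ 3)) :=
        add_le_add hct ((real_inner_le_norm _ _).trans (by gcongr))
    _ = d * t ^ 2 + ‖p‖ * (20 * (K ^ 2 * M * t)) * t ^ 2 := by ring
    _ ≤ d * t ^ 2 + (c' - d) * t ^ 2 := by gcongr
    _ = c' * t ^ 2 := by ring

end Bracket

section LimitBrackets

variable {n : ℕ} {Ω : Set (State n)} {f g : State n → State n} {x₀ p : State n}

theorem exists_eventually_norm_lieBracket_le {V : Set (State n)} (hV : V ∈ 𝓝 x₀)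
    (hf : IsCb01On f V) (hg : IsCb01On g V) :
    ∃ B, ∀ᶠ x in 𝓝 x₀, ‖VectorField.lieBracket ℝ f g x‖ ≤ B := by
  obtain ⟨⟨M, hM⟩, K, hK⟩ := hf
  obtain ⟨⟨N, hN⟩, L, hL⟩ := hg
  refine ⟨L * M + K * N, (eventually_eventually_nhds.2 hV).mono fun x hx => ?_⟩
  have hxV : x ∈ V := hx.self_of_nhds
  refine (norm_sub_le _ _).trans (add_le_add ?_ ?_)
  · exact (ContinuousLinearMap.le_opNorm _ _).trans (mul_le_mul
      (norm_fderiv_le_of_lipschitzOn ℝ hx hL) (hM x hxV) (norm_nonneg _) L.coe_nonneg)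
  · exact (ContinuousLinearMap.le_opNorm _ _).trans (mul_le_mul
      (norm_fderiv_le_of_lipschitzOn ℝ hx hK) (hN x hxV) (norm_nonneg _) K.coe_nonneg)

theorem isBounded_limitBrackets {B : ℝ}
    (hB : ∀ᶠ x in 𝓝 x₀, ‖VectorField.lieBracket ℝ f g x‖ ≤ B) :
    Bornology.IsBounded (limitBrackets Ω f g x₀) := by
  refine (Metric.isBounded_closedBall (x := (0 : State n)) (r := B)).subset ?_
  rintro w ⟨u, -, hux, hw⟩
  rw [mem_closedBall_zero_iff]
  exact le_of_tendsto hw.norm (hux.eventually hB)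

theorem eventually_inner_lieBracket_le {B c c' : ℝ} (hΩ : Ω ∈ 𝓝 x₀)
    (hB : ∀ᶠ x in 𝓝 x₀, ‖VectorField.lieBracket ℝ f g x‖ ≤ B)
    (hc : ∀ w ∈ limitBrackets Ω f g x₀, inner ℝ p w ≤ c) (hcc : c < c') :
    ∀ᶠ x in 𝓝 x₀, DifferentiableAt ℝ f x → DifferentiableAt ℝ g x →
      inner ℝ p (VectorField.lieBracket ℝ f g x) ≤ c' := by
  by_contra hcon
  have hfreq := (not_eventually.1 hcon).and_eventually (hB.and hΩ)
  obtain ⟨u, hux, hu⟩ := exists_seq_forall_of_frequently hfreq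
  obtain ⟨w, -, θ, hθ, hw⟩ := (isCompact_closedBall (0 : State n) B).tendsto_subseq
    fun k => mem_closedBall_zero_iff.2 (hu k).2.1
  have hu' : ∀ k, DifferentiableAt ℝ f (u k) ∧ DifferentiableAt ℝ g (u k) ∧
      c' < inner ℝ p (VectorField.lieBracket ℝ f g (u k)) := fun k => by
    simpa only [Classical.not_imp, not_le] using (hu k).1
  have hmem : w ∈ limitBrackets Ω f g x₀ := ⟨u ∘ θ,
    fun k => ⟨(hu _).2.2, (hu' _).1, (hu' _).2.1⟩, hux.comp hθ.tendsto_atTop, hw⟩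
  have hge : c' ≤ inner ℝ p w :=
    ge_of_tendsto' (tendsto_const_nhds.inner hw) fun k => (hu' (θ k)).2.2.le
  linarith [hc w hmem]

end LimitBrackets

/-! ### Proximal supergradients -/

section Semiconcavity

variable {E : Type*} [NormedAddCommGroup E] [NormedSpace ℝ E] {U : E → ℝ} {B : Set E} {ρ : ℝ}

/-- The semiconcavity inequality in midpoint form, with constant `ρ`, for all pairs of points
of `B`. It is meant for convex `B`, where the restriction to pairs whose segment lies in `B` made in
`SemiconcaveOn` is void. -/
def MidpointSemiconcaveOn (ρ : ℝ) (U : E → ℝ) (B : Set E) : Prop :=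
  ∀ z₁ ∈ B, ∀ z₂ ∈ B, U z₁ + U z₂ - 2 * U (midpoint ℝ z₁ z₂) ≤ ρ * ‖z₁ - z₂‖ ^ 2

theorem MidpointSemiconcaveOn.sub_le_pow_mul_sub (hU : MidpointSemiconcaveOn ρ U B)
    (hB : Convex ℝ B) {u h : E} (hu : u ∈ B) (huh : u + h ∈ B) (k : ℕ) :
    U (u + h) - U u ≤ 2 ^ k * (U (u + ((2 : ℝ) ^ k)⁻¹ • h) - U u)
      + 2 * ρ * (1 - ((2 : ℝ) ^ k)⁻¹) * ‖h‖ ^ 2 := by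
  induction k with
  | zero => simp
  | succ k ih =>
    set v := u + ((2 : ℝ) ^ k)⁻¹ • h with hv
    have hmem : v ∈ B := hB.add_smul_mem hu huh
      ⟨by positivity, inv_le_one_of_one_le₀ (one_le_pow₀ one_le_two)⟩
    have hmid : midpoint ℝ v u = u + ((2 : ℝ) ^ (k + 1))⁻¹ • h := by
      rw [midpoint_comm, midpoint_eq_smul_add, hv, pow_succ, mul_inv, invOf_eq_inv]
      module
    have hnorm : ‖v - u‖ = ((2 : ℝ) ^ k)⁻¹ * ‖h‖ := by
      rw [hv, add_sub_cancel_left, norm_smul, Real.norm_of_nonneg (by positivity)]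
    have hstep := mul_le_mul_of_nonneg_left (hU v hmem u hu) (by positivity : (0 : ℝ) ≤ 2 ^ k)
    rw [hmid, hnorm] at hstep
    have hcancel : (2 : ℝ) ^ k * (ρ * (((2 : ℝ) ^ k)⁻¹ * ‖h‖) ^ 2)
        = ρ * ((2 : ℝ) ^ k)⁻¹ * ‖h‖ ^ 2 := by
      field_simp
    have hhalf : 2 * ρ * (1 - ((2 : ℝ) ^ (k + 1))⁻¹) * ‖h‖ ^ 2
        = 2 * ρ * (1 - ((2 : ℝ) ^ k)⁻¹) * ‖h‖ ^ 2 + ρ * ((2 : ℝ) ^ k)⁻¹ * ‖h‖ ^ 2 := by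
      rw [pow_succ, mul_inv]
      ring
    rw [hhalf, pow_succ]
    rw [hcancel, pow_succ] at hstep
    linarith

theorem MidpointSemiconcaveOn.le_add_fderiv (hU : MidpointSemiconcaveOn ρ U B) (hρ : 0 ≤ ρ)
    (hB : Convex ℝ B) {u h : E} (hu : u ∈ B) (huh : u + h ∈ B) (hd : DifferentiableAt ℝ U u) :
    U (u + h) ≤ U u + fderiv ℝ U u h + 2 * ρ * ‖h‖ ^ 2 := by
  have hpow : Tendsto (fun k : ℕ => ‖(2 : ℝ) ^ k‖) atTop atTop := by
    simpa using tendsto_pow_atTop_atTop_of_one_lt (one_lt_two : (1 : ℝ) < 2)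
  suffices U (u + h) - U u - 2 * ρ * ‖h‖ ^ 2 ≤ fderiv ℝ U u h by linarith
  refine ge_of_tendsto (hd.hasFDerivAt.lim h hpow) (Eventually.of_forall fun k => ?_)
  have hdyadic := hU.sub_le_pow_mul_sub hB hu huh k
  have hnonneg : 0 ≤ 2 * ρ * ((2 : ℝ) ^ k)⁻¹ * ‖h‖ ^ 2 := by positivity
  rw [smul_eq_mul]
  linarith

theorem MidpointSemiconcaveOn.sub_le_mul_norm_sub (hU : MidpointSemiconcaveOn ρ U B) (hρ : 0 ≤ ρ)
    (hB : Convex ℝ B) {b r : ℝ} (hb : ∀ x ∈ B, |U x| ≤ b) (hr : 0 < r) {u w : E}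
    (hu : Metric.closedBall u r ⊆ B) (hw : ‖w - u‖ ≤ r) :
    U u - U w ≤ (2 * b + 2 * ρ * r ^ 2) * (2 / r) * ‖w - u‖ := by
  rcases eq_or_ne w u with rfl | hne
  · simp
  have hd : 0 < ‖w - u‖ := norm_pos_iff.2 (sub_ne_zero.2 hne)
  obtain ⟨k, hk, hk'⟩ := exists_nat_pow_near ((one_le_div hd).2 hw) one_lt_two
  rw [le_div_iff₀ hd] at hk
  rw [div_lt_iff₀ hd] at hk'
  set h : E := (2 : ℝ) ^ k • (w - u) with hh
  have hhr : ‖h‖ ≤ r := by rwa [hh, norm_smul, Real.norm_of_nonneg (by positivity)]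
  have huB : u ∈ B := hu (Metric.mem_closedBall_self hr.le)
  have huhB : u + h ∈ B := hu (by simpa using hhr)
  have hdyadic := hU.sub_le_pow_mul_sub hB huB huhB k
  have hw_eq : u + ((2 : ℝ) ^ k)⁻¹ • h = w := by
    rw [hh, inv_smul_smul₀ (by positivity), add_sub_cancel]
  have hquad : 2 * ρ * (1 - ((2 : ℝ) ^ k)⁻¹) * ‖h‖ ^ 2 ≤ 2 * ρ * r ^ 2 := by
    have hle : 1 - ((2 : ℝ) ^ k)⁻¹ ≤ 1 := sub_le_self _ (by positivity)
    refine mul_le_mul (mul_le_of_le_one_right (by positivity) hle) ?_ (by positivity)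
      (by positivity)
    exact pow_le_pow_left₀ (norm_nonneg _) hhr 2
  rw [hw_eq] at hdyadic
  have hscaled : 2 ^ k * (U u - U w) ≤ 2 * b + 2 * ρ * r ^ 2 := by
    linarith [(abs_le.1 (hb _ huB)).2, (abs_le.1 (hb _ huhB)).1]
  have hone : 1 ≤ 2 ^ k * (2 / r * ‖w - u‖) := by
    rw [pow_succ] at hk'
    rw [← mul_assoc, mul_div_assoc', div_mul_eq_mul_div, one_le_div hr]
    linarith
  have hb0 : 0 ≤ b := (abs_nonneg _).trans (hb u huB)
  refine le_of_mul_le_mul_left (hscaled.trans ?_) (by positivity : (0 : ℝ) < 2 ^ k)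
  linarith [le_mul_of_one_le_right (by positivity : 0 ≤ 2 * b + 2 * ρ * r ^ 2) hone]

theorem MidpointSemiconcaveOn.exists_lipschitzOnWith {x₀ : E} {b R : ℝ}
    (hU : MidpointSemiconcaveOn ρ U (Metric.ball x₀ R)) (hρ : 0 ≤ ρ) (hR : 0 < R)
    (hb : ∀ x ∈ Metric.ball x₀ R, |U x| ≤ b) :
    ∃ C : NNReal, LipschitzOnWith C U (Metric.ball x₀ (R / 4)) := by
  have hb0 : 0 ≤ b := (abs_nonneg _).trans (hb x₀ (Metric.mem_ball_self hR))
  refine ⟨⟨(2 * b + 2 * ρ * (R / 2) ^ 2) * (2 / (R / 2)), by positivity⟩,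
    LipschitzOnWith.of_le_add_mul _ fun u hu w hw => ?_⟩
  rw [Metric.mem_ball] at hu hw
  have hwu : ‖w - u‖ ≤ R / 2 := by
    rw [← dist_eq_norm]
    linarith [dist_triangle_right w u x₀]
  have hle := hU.sub_le_mul_norm_sub hρ (convex_ball x₀ R) hb (half_pos hR)
    (Metric.closedBall_subset_ball' (by linarith)) hwu
  rw [dist_comm, dist_eq_norm]
  exact sub_le_iff_le_add'.1 hle

end Semiconcavity

section Supergradient

/-- `p` is a proximal supergradient of `U` at `x₀`. -/
def IsProximalSupergradientAt {E : Type*} [NormedAddCommGroup E] [InnerProductSpace ℝ E]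
    (U : E → ℝ) (p x₀ : E) : Prop :=
  ∃ σ : ℝ, ∀ᶠ x in 𝓝 x₀, U x ≤ U x₀ + inner ℝ p (x - x₀) + σ * ‖x - x₀‖ ^ 2

theorem IsProximalSupergradientAt.eventually_lt {E : Type*} [NormedAddCommGroup E]
    [InnerProductSpace ℝ E] {U : E → ℝ} {p x₀ : E} (hp : IsProximalSupergradientAt U p x₀)
    {ι : Type*} {l : Filter ι} {s : ι → ℝ} (hs : Tendsto s l (𝓝[>] 0)) {γ : ι → E} {c C : ℝ}
    (hγ : ∀ᶠ t in l, ‖γ t - x₀‖ ≤ C * s t) (hc : c < 0)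
    (hdesc : ∀ᶠ t in l, inner ℝ p (γ t - x₀) ≤ c * s t) : ∀ᶠ t in l, U (γ t) < U x₀ := by
  obtain ⟨σ, hσ⟩ := hp
  have hs0 : Tendsto s l (𝓝 0) := hs.mono_right nhdsWithin_le_nhds
  have hγ0 : Tendsto γ l (𝓝 x₀) :=
    tendsto_iff_norm_sub_tendsto_zero.2 (squeeze_zero' (Eventually.of_forall fun _ => norm_nonneg _)
      hγ (by simpa using hs0.const_mul C))
  have hsmall : ∀ᶠ t in l, |σ| * C ^ 2 * s t < -c := by
    have hlim := hs0.const_mul (|σ| * C ^ 2)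
    rw [mul_zero] at hlim
    exact hlim.eventually_lt_const (neg_pos.2 hc)
  filter_upwards [hγ, hdesc, hγ0.eventually hσ, hsmall, hs.eventually self_mem_nhdsWithin]
    with t hγt hdesct hUt hsmallt hst
  have hquad : σ * ‖γ t - x₀‖ ^ 2 ≤ |σ| * (C * s t) ^ 2 :=
    mul_le_mul (le_abs_self σ) (pow_le_pow_left₀ (norm_nonneg _) hγt 2) (sq_nonneg _)
      (abs_nonneg σ)
  have hlt : |σ| * (C * s t) ^ 2 < -c * s t := by
    calc |σ| * (C * s t) ^ 2 = |σ| * C ^ 2 * s t * s t := by ring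
      _ < -c * s t := mul_lt_mul_of_pos_right hsmallt hst
  linarith

variable {n : ℕ} {Ω : Set (State n)} {U : State n → ℝ} {x₀ p : State n} {R : ℝ}

theorem MidpointSemiconcaveOn.isProximalSupergradientAt {ρ : ℝ}
    (hU : MidpointSemiconcaveOn ρ U (Metric.ball x₀ R)) (hρ : 0 ≤ ρ) (hR : 0 < R)
    (hc : ContinuousOn U (Metric.ball x₀ R)) (hp : p ∈ limitingGradients Ω U x₀) :
    IsProximalSupergradientAt U p x₀ := by
  obtain ⟨u, hu, hux, hup⟩ := hp
  refine ⟨2 * ρ, ?_⟩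
  filter_upwards [Metric.ball_mem_nhds x₀ hR] with x hx
  have hux' : Tendsto (fun k => u k + (x - x₀)) atTop (𝓝 x) := by
    simpa using hux.add_const (x - x₀)
  have hball : ∀ z ∈ Metric.ball x₀ R, Metric.ball x₀ R ∈ 𝓝 z := fun z hz =>
    Metric.isOpen_ball.mem_nhds hz
  have hx₀ := Metric.mem_ball_self (x := x₀) hR
  refine le_of_tendsto_of_tendsto ((hc.continuousAt (hball x hx)).tendsto.comp hux')
    ((((hc.continuousAt (hball x₀ hx₀)).tendsto.comp hux).add
      (hup.inner tendsto_const_nhds)).add tendsto_const_nhds) ?_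
  filter_upwards [hux (hball x₀ hx₀), hux' (hball x hx)] with k hk hk'
  have hle := hU.le_add_fderiv hρ (convex_ball x₀ R) hk hk' (hu k).2.1
  rwa [← InnerProductSpace.toDual_symm_apply] at hle

theorem limitingGradients_nonempty [Nontrivial (State n)] (hR : 0 < R)
    (hΩ : Metric.ball x₀ R ⊆ Ω) {C : NNReal} (hU : LipschitzOnWith C U (Metric.ball x₀ R)) :
    (limitingGradients Ω U x₀).Nonempty := by
  have hae : ∀ᵐ x : State n,
      (x ∈ Metric.ball x₀ R → DifferentiableWithinAt ℝ U (Metric.ball x₀ R) x) ∧ x ≠ x₀ :=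
    hU.ae_differentiableWithinAt_of_mem.and
      (MeasureTheory.compl_mem_ae_iff.2 (MeasureTheory.measure_singleton x₀))
  obtain ⟨u, hu, hux⟩ := mem_closure_iff_seq_limit.1
    ((MeasureTheory.Measure.dense_of_ae hae).open_subset_closure_inter Metric.isOpen_ball
      (Metric.mem_ball_self hR))
  have hnhds : ∀ k, Metric.ball x₀ R ∈ 𝓝 (u k) := fun k => Metric.isOpen_ball.mem_nhds (hu k).1
  have hbound : ∀ k, gradient U (u k) ∈ Metric.closedBall 0 (C : ℝ) := fun k => by
    rw [mem_closedBall_zero_iff, gradient, LinearIsometryEquiv.norm_map]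
    exact norm_fderiv_le_of_lipschitzOn ℝ (hnhds k) hU
  obtain ⟨p, -, θ, hθ, hp⟩ := (isCompact_closedBall (0 : State n) C).tendsto_subseq hbound
  exact ⟨p, u ∘ θ, fun k => ⟨hΩ (hu _).1, ((hu _).2.1 (hu _).1).differentiableAt (hnhds _),
    (hu _).2.2⟩, hux.comp hθ.tendsto_atTop, hp⟩

theorem LocallySemiconcaveOn.exists_isProximalSupergradientAt [Nontrivial (State n)]
    (hU : LocallySemiconcaveOn U Ω) (hΩ : IsOpen Ω) (hx₀ : x₀ ∈ Ω) :
    ∃ p ∈ limitingGradients Ω U x₀, IsProximalSupergradientAt U p x₀ := by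
  obtain ⟨R, hR, hRΩ⟩ := Metric.nhds_basis_closedBall.mem_iff.1 (hΩ.mem_nhds hx₀)
  have hsub : Metric.ball x₀ R ⊆ Metric.closedBall x₀ R := Metric.ball_subset_closedBall
  obtain ⟨hc, ρ, hρ, hmid⟩ := hU _ hRΩ (isCompact_closedBall x₀ R)
  have hball : MidpointSemiconcaveOn ρ U (Metric.ball x₀ R) := fun z₁ h₁ z₂ h₂ =>
    hmid z₁ (hsub h₁) z₂ (hsub h₂) ((convex_closedBall x₀ R).segment_subset (hsub h₁) (hsub h₂))
  obtain ⟨b, hb⟩ := (isCompact_closedBall x₀ R).exists_bound_of_continuousOn hc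
  obtain ⟨C, hC⟩ := hball.exists_lipschitzOnWith hρ.le hR fun x hx => hb x (hsub hx)
  obtain ⟨p, hp⟩ := limitingGradients_nonempty (by positivity : 0 < R / 4)
    ((Metric.ball_subset_closedBall.trans
      (Metric.closedBall_subset_closedBall (by linarith))).trans hRΩ) hC
  exact ⟨p, hp, hball.isProximalSupergradientAt hρ.le hR (hc.mono hsub) hp⟩

end Supergradient

/-! ### Local descent -/

section LocalDescent

/-- Near `x₀` the system can be steered inside `V`, in a common time, to end points `e x` which
depend continuously on the initial point and at which `U` is below `U x₀` for `x = x₀`. -/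
def HasLocalDescent {E : Type*} [NormedAddCommGroup E] [NormedSpace ℝ E] {m : ℕ}
    (f : Fin m → E → E) (V : Set E) (U : E → ℝ) (x₀ : E) : Prop :=
  ∃ (e : E → E) (τ : ℝ), 0 < τ ∧ Continuous e ∧ U (e x₀) < U x₀ ∧
    ∀ᶠ x in 𝓝 x₀, Steers f V x (e x) τ

theorem HasLocalDescent.mono {E : Type*} [NormedAddCommGroup E] [NormedSpace ℝ E] {m : ℕ}
    {f : Fin m → E → E} {V W : Set E} {U : E → ℝ} {x₀ : E} (h : HasLocalDescent f V U x₀)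
    (hVW : V ⊆ W) : HasLocalDescent f W U x₀ :=
  let ⟨e, τ, hτ, he, hlt, hst⟩ := h
  ⟨e, τ, hτ, he, hlt, hst.mono fun _ hx => hx.mono hVW⟩

namespace IsUnitFlow

variable {E : Type*} [NormedAddCommGroup E] [NormedSpace ℝ E] {F : E → E} {φ : E → ℝ → E} {M : ℝ}

theorem tendsto_prod (h : IsUnitFlow F φ) (hM : ∀ x, ‖F x‖ ≤ M) (x₀ : E) :
    Tendsto (fun q : ℝ × E => φ q.2 q.1) (𝓝[>] 0 ×ˢ 𝓝 x₀) (𝓝 x₀) := by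
  have htime : ∀ᶠ q : ℝ × E in 𝓝[>] (0 : ℝ) ×ˢ 𝓝 x₀, q.1 ∈ Ioc (0 : ℝ) 1 :=
    tendsto_fst.eventually (Ioc_mem_nhdsGT zero_lt_one)
  have hzero : Tendsto (fun q : ℝ × E => M * q.1 + ‖q.2 - x₀‖) (𝓝[>] 0 ×ˢ 𝓝 x₀) (𝓝 0) := by
    have hcont : Tendsto (fun q : ℝ × E => M * q.1 + ‖q.2 - x₀‖) (𝓝 (0, x₀)) (𝓝 0) :=
      Continuous.tendsto' (by fun_prop) _ _ (by simp)
    rw [nhds_prod_eq] at hcont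
    exact hcont.mono_left (prod_mono_left _ nhdsWithin_le_nhds)
  refine tendsto_iff_norm_sub_tendsto_zero.2
    (squeeze_zero' (Eventually.of_forall fun _ => norm_nonneg _) ?_ hzero)
  filter_upwards [htime] with q hq
  rw [← sub_add_sub_cancel (φ q.2 q.1) q.2 x₀]
  exact norm_add_le_of_le (h.norm_sub_le hM _ (Ioc_subset_Icc_self hq)) le_rfl

theorem tendsto_prodMk (h : IsUnitFlow F φ) (hM : ∀ x, ‖F x‖ ≤ M) (x₀ : E) :
    Tendsto (fun q : ℝ × E => (q.1, φ q.2 q.1)) (𝓝[>] 0 ×ˢ 𝓝 x₀) (𝓝[>] 0 ×ˢ 𝓝 x₀) :=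
  tendsto_fst.prodMk (h.tendsto_prod hM x₀)

theorem eventually_steers {m : ℕ} {f : Fin m → E → E} {a : Fin m → ℝ} {V : Set E} {x₀ : E}
    (h : IsUnitFlow F φ) (hM : ∀ x, ‖F x‖ ≤ M) (ha : a ∈ controlSet m) (hV : V ∈ 𝓝 x₀)
    (hF : ∀ v ∈ V, F v = ∑ i, a i • f i v) :
    ∀ᶠ q : ℝ × E in 𝓝[>] (0 : ℝ) ×ˢ 𝓝 x₀, Steers f V q.2 (φ q.2 q.1) q.1 := by
  obtain ⟨A, hA, B, hB, hAB⟩ := mem_prod_iff.1 (h.tendsto_prod hM x₀ hV)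
  obtain ⟨δ, hδ, hδA⟩ := mem_nhdsGT_iff_exists_Ioc_subset.1 hA
  have htime : ∀ᶠ t in 𝓝[>] (0 : ℝ), t ≤ 1 ∧ Ioc 0 t ⊆ A := by
    filter_upwards [Ioc_mem_nhdsGT zero_lt_one, Ioc_mem_nhdsGT hδ] with t ht1 ht2
    exact ⟨ht1.2, (Ioc_subset_Ioc_right ht2.2).trans hδA⟩
  filter_upwards [prod_mem_prod htime (inter_mem hB hV)] with ⟨t, x⟩ ⟨ht, hx⟩
  refine h.steers ha hF ht.1 fun s hs => ?_
  rcases hs.1.eq_or_lt with rfl | hs0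
  · rw [h.init]
    exact hx.2
  · exact hAB (mk_mem_prod (ht.2 ⟨hs0, hs.2⟩) hx.1)

end IsUnitFlow

theorem apply_eq_sum_single_smul {E : Type*} [AddCommGroup E] [Module ℝ E] {m : ℕ}
    (f : Fin m → E → E) (i : Fin m) (x : E) :
    f i x = ∑ l, (Pi.single i 1 : Fin m → ℝ) l • f l x := by
  simp [Pi.single_apply]

theorem neg_apply_eq_sum_single_smul {E : Type*} [AddCommGroup E] [Module ℝ E] {m : ℕ}
    (f : Fin m → E → E) (i : Fin m) (x : E) :
    -f i x = ∑ l, (-Pi.single i 1 : Fin m → ℝ) l • f l x := by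
  simp [Pi.single_apply]

theorem eventually_steers_fourLegs {E : Type*} [NormedAddCommGroup E] [NormedSpace ℝ E]
    {F G : E → E} {K : NNReal} {M : ℝ} {φ ψ φ' ψ' : E → ℝ → E} {m : ℕ} {f : Fin m → E → E}
    {V : Set E} {x₀ : E} {i j : Fin m} (hF : BoundedLipschitzWith K M F)
    (hG : BoundedLipschitzWith K M G)
    (hφ : IsUnitFlow F φ) (hψ : IsUnitFlow G ψ) (hφ' : IsUnitFlow (-F) φ')
    (hψ' : IsUnitFlow (-G) ψ') (hV : V ∈ 𝓝 x₀) (hFf : EqOn F (f i) V) (hGf : EqOn G (f j) V) :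
    ∀ᶠ q : ℝ × E in 𝓝[>] (0 : ℝ) ×ˢ 𝓝 x₀,
      Steers f V q.2 (fourLegs φ ψ φ' ψ' q.1 q.2) (q.1 + q.1 + q.1 + q.1) := by
  have lim₁ := hφ.tendsto_prodMk hF.norm_le x₀
  have lim₂ := (hψ.tendsto_prodMk hG.norm_le x₀).comp lim₁
  have lim₃ := (hφ'.tendsto_prodMk hF.neg.norm_le x₀).comp lim₂
  have leg₁ := hφ.eventually_steers hF.norm_le ⟨i, Or.inl rfl⟩ hV fun v hv =>
    (hFf hv).trans (apply_eq_sum_single_smul f i v)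
  have leg₂ := hψ.eventually_steers hG.norm_le ⟨j, Or.inl rfl⟩ hV fun v hv =>
    (hGf hv).trans (apply_eq_sum_single_smul f j v)
  have leg₃ := hφ'.eventually_steers hF.neg.norm_le ⟨i, Or.inr rfl⟩ hV fun v hv =>
    (congrArg Neg.neg (hFf hv)).trans (neg_apply_eq_sum_single_smul f i v)
  have leg₄ := hψ'.eventually_steers hG.neg.norm_le ⟨j, Or.inr rfl⟩ hV fun v hv =>
    (congrArg Neg.neg (hGf hv)).trans (neg_apply_eq_sum_single_smul f j v)
  filter_upwards [tendsto_fst.eventually self_mem_nhdsWithin, leg₁, lim₁.eventually leg₂,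
    lim₂.eventually leg₃, lim₃.eventually leg₄] with q hq h₁ h₂ h₃ h₄
  have hq0 : 0 ≤ q.1 := (mem_Ioi.1 hq).le
  exact ((h₁.trans h₂ hq0 hq0).trans h₃ (by positivity) hq0).trans h₄ (by positivity) hq0

namespace IsProximalSupergradientAt

variable {E : Type*} [NormedAddCommGroup E] [InnerProductSpace ℝ E] {U : E → ℝ} {p x₀ : E}
  {m : ℕ} {f : Fin m → E → E} {V : Set E} {K : NNReal} {M : ℝ} {F G : E → E}

theorem hasLocalDescent_of_field [CompleteSpace E] (hp : IsProximalSupergradientAt U p x₀)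
    (hV : V ∈ 𝓝 x₀) (hF : BoundedLipschitzWith K M F) {a : Fin m → ℝ} (ha : a ∈ controlSet m)
    (hFf : ∀ v ∈ V, F v = ∑ i, a i • f i v) (hneg : inner ℝ p (F x₀) < 0) :
    HasLocalDescent f V U x₀ := by
  obtain ⟨φ, hφ⟩ := hF.exists_isUnitFlow
  obtain ⟨c, hpc, hc⟩ := exists_between hneg
  have herr : Tendsto (fun t : ℝ => ‖p‖ * (K * (M * t))) (𝓝 0) (𝓝 0) :=
    Continuous.tendsto' (by fun_prop) _ _ (by simp)
  have hunit : ∀ᶠ t in 𝓝[>] (0 : ℝ), t ∈ Ioc (0 : ℝ) 1 := Ioc_mem_nhdsGT zero_lt_one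
  have hdesc : ∀ᶠ t in 𝓝[>] (0 : ℝ), inner ℝ p (φ x₀ t - x₀) ≤ c * t := by
    filter_upwards [nhdsWithin_le_nhds (herr.eventually_lt_const (sub_pos.2 hpc)), hunit]
      with t hsmall ht
    have hdisp := hφ.norm_displacement_sub_smul_le hF x₀ x₀ (Ioc_subset_Icc_self ht)
    rw [sub_self, norm_zero, zero_add] at hdisp
    calc inner ℝ p (φ x₀ t - x₀)
        = t * inner ℝ p (F x₀) + inner ℝ p (φ x₀ t - x₀ - t • F x₀) := by
          rw [← real_inner_smul_right, ← inner_add_right, add_sub_cancel]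
      _ ≤ t * inner ℝ p (F x₀) + ‖p‖ * (K * (M * t) * t) := by
          gcongr
          exact (real_inner_le_norm _ _).trans (by gcongr)
      _ = t * inner ℝ p (F x₀) + ‖p‖ * (K * (M * t)) * t := by ring
      _ ≤ t * inner ℝ p (F x₀) + (c - inner ℝ p (F x₀)) * t := by
          have ht0 := ht.1.le
          gcongr
      _ = c * t := by ring
  have hspeed : ∀ᶠ t in 𝓝[>] (0 : ℝ), ‖φ x₀ t - x₀‖ ≤ M * t :=
    hunit.mono fun t ht => hφ.norm_sub_le hF.norm_le x₀ (Ioc_subset_Icc_self ht)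
  obtain ⟨t, ht, hlt, hst⟩ := (hunit.and ((hp.eventually_lt tendsto_id hspeed hc hdesc).and
    (hφ.eventually_steers hF.norm_le ha hV hFf).curry)).exists
  exact ⟨fun x => φ x t, t, ht.1, hφ.continuous_apply hF.lipschitz (Ioc_subset_Icc_self ht), hlt,
    hst⟩

theorem hasLocalDescent_of_lieBracket [FiniteDimensional ℝ E]
    (hp : IsProximalSupergradientAt U p x₀) (hV : V ∈ 𝓝 x₀) (hF : BoundedLipschitzWith K M F)
    (hG : BoundedLipschitzWith K M G) {i j : Fin m} (hFf : EqOn F (f i) V) (hGf : EqOn G (f j) V)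
    {c : ℝ} (hc : c < 0) (hbr : ∀ᶠ x in 𝓝 x₀, DifferentiableAt ℝ F x → DifferentiableAt ℝ G x →
      inner ℝ p (VectorField.lieBracket ℝ F G x) ≤ c) :
    HasLocalDescent f V U x₀ := by
  have := FiniteDimensional.complete ℝ E
  obtain ⟨φ, hφ⟩ := hF.exists_isUnitFlow
  obtain ⟨ψ, hψ⟩ := hG.exists_isUnitFlow
  obtain ⟨φ', hφ'⟩ := hF.neg.exists_isUnitFlow
  obtain ⟨ψ', hψ'⟩ := hG.neg.exists_isUnitFlow
  have hunit : ∀ᶠ t in 𝓝[>] (0 : ℝ), t ∈ Ioc (0 : ℝ) 1 := Ioc_mem_nhdsGT zero_lt_one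
  have hsq : Tendsto (fun t : ℝ => t ^ 2) (𝓝[>] 0) (𝓝[>] 0) :=
    tendsto_nhdsWithin_iff.2 ⟨(Continuous.tendsto' (by fun_prop) _ _ (by simp)).mono_left
      nhdsWithin_le_nhds, hunit.mono fun t ht => pow_pos ht.1 2⟩
  have hspeed : ∀ᶠ t in 𝓝[>] (0 : ℝ), ‖fourLegs φ ψ φ' ψ' t x₀ - x₀‖ ≤ 10 * (K * M) * t ^ 2 := by
    filter_upwards [hunit] with t ht
    simpa only [mul_assoc] using
      norm_fourLegs_sub_le hF hG hφ hψ hφ' hψ' x₀ (Ioc_subset_Icc_self ht)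
  have hdesc := eventually_inner_fourLegs_le hF hG hφ hψ hφ' hψ' (by linarith : c < c / 2) hbr
  obtain ⟨t, ht, hlt, hst⟩ := (hunit.and ((hp.eventually_lt hsq hspeed (by linarith) hdesc).and
    (eventually_steers_fourLegs hF hG hφ hψ hφ' hψ' hV hFf hGf).curry)).exists
  have ht1 := Ioc_subset_Icc_self ht
  have ht0 := ht.1
  exact ⟨fourLegs φ ψ φ' ψ' t, t + t + t + t, by positivity,
    (hψ'.continuous_apply hG.neg.lipschitz ht1).comp
      ((hφ'.continuous_apply hF.neg.lipschitz ht1).comp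
        ((hψ.continuous_apply hG.lipschitz ht1).comp (hφ.continuous_apply hF.lipschitz ht1))),
    hlt, hst⟩

end IsProximalSupergradientAt

variable {n m : ℕ} {f : Fin m → State n → State n} {U : State n → ℝ} {x₀ p : State n}

theorem exists_boundedLipschitzWith_eqOn {C : Set (State n)} (hne : C.Nonempty) (hC : IsClosed C)
    (hconv : Convex ℝ C) (hf : ∀ i, IsCb01On (f i) C) :
    ∃ (K : NNReal) (M : ℝ) (F : Fin m → State n → State n),
      ∀ i, BoundedLipschitzWith K M (F i) ∧ EqOn (F i) (f i) C := by
  obtain ⟨P, hP, hPC, hPid⟩ := exists_nonexpansive_retraction hne hC.isComplete hconv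
  choose M hM using fun i => (hf i).1
  choose K hK using fun i => (hf i).2
  refine ⟨∑ i, K i, ∑ i, |M i|, fun i x => f i (P x), fun i => ⟨⟨?_, fun x => ?_⟩, fun x hx => ?_⟩⟩
  · have hsum : LipschitzOnWith (∑ i, K i) (f i) C :=
      (hK i).weaken (Finset.single_le_sum (f := K) (fun _ _ => zero_le) (Finset.mem_univ i))
    have hcomp := hsum.comp hP.lipschitzOnWith fun x (_ : x ∈ univ) => hPC x
    rwa [mul_one, lipschitzOnWith_univ] at hcomp
  · exact ((hM i _ (hPC x)).trans (le_abs_self _)).trans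
      (Finset.single_le_sum (f := fun i => |M i|) (fun _ _ => abs_nonneg _) (Finset.mem_univ i))
  · exact congrArg (f i) (hPid hx)

theorem exists_inner_lt_of_hamiltonian2_neg {Ω : Set (State n)}
    (hbd : ∀ i j, Bornology.IsBounded (limitBrackets Ω (f i) (f j) x₀))
    (hH : hamiltonian2 Ω f x₀ p < 0) :
    (∃ i, inner ℝ p (f i x₀) < 0 ∨ inner ℝ p (-f i x₀) < 0) ∨
      ∃ i j, ∃ c < 0, ∀ w ∈ limitBrackets Ω (f i) (f j) x₀, inner ℝ p w ≤ c := by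
  have hne : ((fun v : Set (State n) => sSup ((fun w => inner ℝ p w) '' v)) ''
      family2 Ω f x₀).Nonempty := by
    by_contra hempty
    rw [not_nonempty_iff_eq_empty] at hempty
    rw [hamiltonian2, hempty, Real.sInf_empty] at hH
    exact lt_irrefl _ hH
  obtain ⟨_, ⟨v, hv, rfl⟩, hlt⟩ := exists_lt_of_csInf_lt hne hH
  rcases hv with ⟨i, rfl | rfl⟩ | ⟨i, j, rfl⟩
  · exact Or.inl ⟨i, Or.inl (by simpa using hlt)⟩
  · exact Or.inl ⟨i, Or.inr (by simpa using hlt)⟩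
  · refine Or.inr ⟨i, j, _, hlt, fun w hw => ?_⟩
    have hbdd := (innerSL ℝ p).lipschitz.isBounded_image (isBounded_convexHull.2 (hbd i j))
    exact le_csSup hbdd.bddAbove ⟨w, subset_convexHull ℝ _ hw, rfl⟩

theorem IsProximalSupergradientAt.hasLocalDescent (hp : IsProximalSupergradientAt U p x₀)
    {V Ω : Set (State n)} (hV : V ∈ 𝓝 x₀) (hf : ∀ i, IsCb01On (f i) V) (hΩ : Ω ∈ 𝓝 x₀)
    (hH : hamiltonian2 Ω f x₀ p < 0) : HasLocalDescent f V U x₀ := by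
  obtain ⟨R, hR, hRV⟩ := Metric.nhds_basis_closedBall.mem_iff.1 hV
  have hball := Metric.closedBall_mem_nhds x₀ hR
  obtain ⟨K, M, F, hF⟩ := exists_boundedLipschitzWith_eqOn (f := f)
    ⟨x₀, Metric.mem_closedBall_self hR.le⟩ Metric.isClosed_closedBall (convex_closedBall x₀ R)
    fun i => ⟨(hf i).1.imp fun M hM x hx => hM x (hRV hx), (hf i).2.imp fun K hK => hK.mono hRV⟩
  choose B hB using fun i j => exists_eventually_norm_lieBracket_le hV (hf i) (hf j)
  refine HasLocalDescent.mono ?_ hRV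
  rcases exists_inner_lt_of_hamiltonian2_neg (fun i j => isBounded_limitBrackets (hB i j)) hH with
    ⟨i, hneg | hneg⟩ | ⟨i, j, c, hc, hbr⟩
  · rw [← (hF i).2 (mem_of_mem_nhds hball)] at hneg
    exact hp.hasLocalDescent_of_field hball (hF i).1 ⟨i, Or.inl rfl⟩
      (fun v hv => ((hF i).2 hv).trans (apply_eq_sum_single_smul f i v)) hneg
  · rw [← (hF i).2 (mem_of_mem_nhds hball)] at hneg
    exact hp.hasLocalDescent_of_field hball (hF i).1.neg ⟨i, Or.inr rfl⟩
      (fun v hv => (congrArg Neg.neg ((hF i).2 hv)).trans (neg_apply_eq_sum_single_smul f i v)) hneg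
  · refine hp.hasLocalDescent_of_lieBracket hball (hF i).1 (hF j).1 (hF i).2 (hF j).2
      (by linarith : c / 2 < 0) ?_
    have heq : ∀ l, ∀ᶠ x in 𝓝 x₀, F l =ᶠ[𝓝 x] f l := fun l =>
      ((hF l).2.eventuallyEq_of_mem hball).eventuallyEq_nhds
    filter_upwards [eventually_inner_lieBracket_le hΩ (hB i j) hbr (by linarith : c < c / 2),
      heq i, heq j] with x hx hi hj hFx hGx
    rw [hi.lieBracket_vectorField_eq hj]
    exact hx (hi.differentiableAt_iff.1 hFx) (hj.differentiableAt_iff.1 hGx)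

theorem IsDegreeTwoCLF.hasLocalDescent {T : Set (State n)} (hU : IsDegreeTwoCLF f T U)
    (hT : IsClosed T) (hTne : T.Nonempty)
    (hf : ∀ Ω : Set (State n), IsOpen Ω → Bornology.IsBounded Ω → ∀ i, IsCb01On (f i) (Ω \ T))
    (hx₀ : x₀ ∈ Tᶜ) {ε : ℝ} (hε : 0 < ε) : HasLocalDescent f (Metric.ball x₀ ε \ T) U x₀ := by
  obtain ⟨z, hz⟩ := hTne
  have hnt : Nontrivial (State n) := ⟨x₀, z, fun h => hx₀ (h ▸ hz)⟩
  obtain ⟨p, hp, hsup⟩ :=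
    hU.locallySemiconcave.exists_isProximalSupergradientAt hT.isOpen_compl hx₀
  have hT_nhds := hT.isOpen_compl.mem_nhds hx₀
  exact hsup.hasLocalDescent (inter_mem (Metric.ball_mem_nhds x₀ hε) hT_nhds)
    (hf _ Metric.isOpen_ball Metric.isBounded_ball) hT_nhds (hU.decrease x₀ hx₀ p hp)

end LocalDescent

/-! ### Halving strategies -/

section Levels

variable {E : Type*} {T : Set E} {U : E → ℝ} {b c d Θ : ℝ}

/-- The sublevel set of `U` at level `c`, in the domain `Tᶜ` of the control system. -/
def sublevel (T : Set E) (U : E → ℝ) (c : ℝ) : Set E :=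
  {v | v ∈ Tᶜ ∧ U v ≤ c}

theorem sublevel_mono (hcd : c ≤ d) : sublevel T U c ⊆ sublevel T U d :=
  fun _ hv => ⟨hv.1, hv.2.trans hcd⟩

variable [NormedAddCommGroup E] [NormedSpace ℝ E] {m : ℕ} {f : Fin m → E → E} {x : E}

/-- From `x`, the value of `U` can be brought down to `c` in positive time at most `Θ` without
exceeding `d` on the way. -/
def ReachesLevel (f : Fin m → E → E) (T : Set E) (U : E → ℝ) (x : E) (c d Θ : ℝ) : Prop :=
  ∃ z τ, 0 < τ ∧ τ ≤ Θ ∧ Steers f (sublevel T U d) x z τ ∧ U z ≤ c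

namespace ReachesLevel

variable {c' d' Θ' : ℝ}

theorem mono (h : ReachesLevel f T U x c d Θ) (hc : c ≤ c') (hd : d ≤ d') (hΘ : Θ ≤ Θ') :
    ReachesLevel f T U x c' d' Θ' := by
  obtain ⟨z, τ, hτ, hτΘ, hst, hz⟩ := h
  exact ⟨z, τ, hτ, hτΘ.trans hΘ, hst.mono (sublevel_mono hd), hz.trans hc⟩

theorem of_forall_descent {l ε η : ℝ}
    (h : ∀ x ∈ Tᶜ, l ≤ U x → U x ≤ b → ReachesLevel f T U x (U x - η) (U x + ε) Θ)
    (hη : 0 ≤ η) (k : ℕ) (hx : x ∈ Tᶜ) (hlx : l ≤ U x) (hxb : U x ≤ b) (hxk : U x ≤ l + k * η) :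
    ReachesLevel f T U x l (U x + ε) ((k + 1) * Θ) := by
  induction k generalizing x with
  | zero =>
    simp only [Nat.cast_zero, zero_mul, add_zero] at hxk
    exact (h x hx hlx hxb).mono (by linarith) le_rfl (by simp)
  | succ k ih =>
    obtain ⟨z, τ, hτ, hτΘ, hst, hz⟩ := h x hx hlx hxb
    have hkΘ : 0 ≤ ((k : ℝ) + 1) * Θ := mul_nonneg k.cast_add_one_pos.le (hτ.le.trans hτΘ)
    push_cast at hxk ⊢
    rcases le_or_gt (U z) l with hzl | hlz
    · exact ⟨z, τ, hτ, by linarith, hst, hzl⟩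
    · obtain ⟨w, σ, hσ, hσΘ, hst', hw⟩ :=
        ih (hst.end_mem hτ.le).1 hlz.le (by linarith) (by linarith)
      exact ⟨w, τ + σ, by linarith, by linarith,
        hst.trans (hst'.mono (sublevel_mono (by linarith))) hτ.le hσ.le, hw⟩

end ReachesLevel

theorem exists_forall_reachesLevel_of_isCompact {C : Set E} {ε : ℝ} (hC : IsCompact C)
    (h : ∀ x₀ ∈ C, ∃ η > 0, ∃ Θ, ∀ᶠ x in 𝓝 x₀, ReachesLevel f T U x (U x - η) (U x + ε) Θ) :
    ∃ η > 0, ∃ Θ, ∀ x ∈ C, ReachesLevel f T U x (U x - η) (U x + ε) Θ := by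
  refine hC.induction_on (p := fun C => ∃ η > 0, ∃ Θ, ∀ x ∈ C,
    ReachesLevel f T U x (U x - η) (U x + ε) Θ) ⟨1, one_pos, 0, by simp⟩ ?_ ?_ fun x hx => ?_
  · rintro s t hst ⟨η, hη, Θ, ht⟩
    exact ⟨η, hη, Θ, fun x hx => ht x (hst hx)⟩
  · rintro s t ⟨η, hη, Θ, hs⟩ ⟨η', hη', Θ', ht⟩
    refine ⟨min η η', lt_min hη hη', max Θ Θ', ?_⟩
    rintro x (hx | hx)
    · exact (hs x hx).mono (sub_le_sub_left (min_le_left _ _) _) le_rfl (le_max_left _ _)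
    · exact (ht x hx).mono (sub_le_sub_left (min_le_right _ _) _) le_rfl (le_max_right _ _)
  · obtain ⟨η, hη, Θ, hnhds⟩ := h x hx
    exact ⟨_, mem_nhdsWithin_of_mem_nhds hnhds, η, hη, Θ, fun _ => id⟩

/-- A feedback strategy that, from each `x` outside the target, halves the value of `U` in time
`τ x` by steering to `Z x`, at most doubling `U` on the way; the times are bounded on each shell
`{a ≤ U ≤ b}` with `0 < a`. -/
structure IsHalvingStrategy (f : Fin m → E → E) (T : Set E) (U : E → ℝ) (Z : E → E)
    (τ : E → ℝ) : Prop where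
  time_pos : ∀ x ∈ Tᶜ, 0 < τ x
  steers : ∀ x ∈ Tᶜ, Steers f (sublevel T U (2 * U x)) x (Z x) (τ x)
  le_half : ∀ x ∈ Tᶜ, U (Z x) ≤ U x / 2
  time_bounded : ∀ a b, 0 < a → ∃ Θ ≥ 0, ∀ x ∈ Tᶜ, a ≤ U x → U x ≤ b → τ x ≤ Θ

theorem exists_isHalvingStrategy (hpos : ∀ x ∈ Tᶜ, 0 < U x)
    (h : ∀ a b, 0 < a → ∃ Θ, ∀ x ∈ Tᶜ, a ≤ U x → U x ≤ b →
      ReachesLevel f T U x (U x / 2) (2 * U x) Θ) :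
    ∃ Z τ, IsHalvingStrategy f T U Z τ := by
  let reachTimes : E → Set ℝ := fun x => {Θ | ReachesLevel f T U x (U x / 2) (2 * U x) Θ}
  have hbdd : ∀ x, BddBelow (reachTimes x) := fun x =>
    ⟨0, fun Θ ⟨_, _, hτ, hτΘ, _⟩ => hτ.le.trans hτΘ⟩
  -- Nearly optimal times inherit every bound on the times in which halving is possible.
  have hnear : ∀ x ∈ Tᶜ, ReachesLevel f T U x (U x / 2) (2 * U x) (sInf (reachTimes x) + 1) := by
    intro x hx
    obtain ⟨Θ, hΘ⟩ := h (U x) (U x) (hpos x hx)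
    obtain ⟨Θ', hΘ', hlt⟩ := exists_lt_of_csInf_lt ⟨Θ, hΘ x hx le_rfl le_rfl⟩
      (lt_add_one (sInf (reachTimes x)))
    exact ReachesLevel.mono hΘ' le_rfl le_rfl hlt.le
  choose! Z τ hτ hτ_le hst hhalf using hnear
  refine ⟨Z, τ, hτ, hst, hhalf, fun a b ha => ?_⟩
  obtain ⟨Θ, hΘ⟩ := h a b ha
  refine ⟨max 0 (Θ + 1), le_max_left _ _, fun x hx hax hxb => (hτ_le x hx).trans ?_⟩
  exact (add_le_add_left (csInf_le (hbdd x) (hΘ x hx hax hxb)) 1).trans (le_max_right _ _)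

end Levels

section Lyapunov

variable {n m : ℕ} {T : Set (State n)} {f : Fin m → State n → State n} {U : State n → ℝ}
  {x₀ : State n} {ε a b : ℝ}

theorem isCompact_infDist_le (hTne : T.Nonempty) (hT_frontier : IsCompact (frontier T)) (R : ℝ) :
    IsCompact (closure Tᶜ ∩ {x | Metric.infDist x T ≤ R}) := by
  refine Metric.isCompact_of_isClosed_isBounded
    (isClosed_closure.inter (isClosed_le (Metric.continuous_infDist_pt T) continuous_const)) ?_
  refine (hT_frontier.isBounded.cthickening (δ := R)).subset fun x hx => ?_
  by_cases hxT : x ∈ T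
  · refine Metric.self_subset_cthickening _ ?_
    rw [frontier_eq_closure_inter_closure]
    exact ⟨subset_closure hxT, hx.1⟩
  · obtain ⟨q, hq, hdist⟩ := exists_mem_frontier_infDist_compl_eq_dist (mem_compl hxT)
      (compl_ne_univ.2 hTne)
    rw [frontier_compl] at hq
    rw [compl_compl] at hdist
    exact Metric.mem_cthickening_of_dist_le x q R _ hq (hdist ▸ hx.2)

namespace IsDegreeTwoCLF

theorem mem_compl (hU : IsDegreeTwoCLF f T U) {x : State n} (hx : x ∈ closure Tᶜ)
    (hpos : 0 < U x) : x ∈ Tᶜ := fun hxT => by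
  refine hpos.ne' (hU.zero x ?_)
  rw [frontier_eq_closure_inter_closure]
  exact ⟨subset_closure hxT, hx⟩

theorem continuousAt (hU : IsDegreeTwoCLF f T U) (hT : IsClosed T) (hx₀ : x₀ ∈ Tᶜ) :
    ContinuousAt U x₀ :=
  hU.continuousOn.continuousAt (mem_of_superset (hT.isOpen_compl.mem_nhds hx₀) subset_closure)

theorem exists_eventually_reachesLevel (hU : IsDegreeTwoCLF f T U) (hT : IsClosed T)
    (hTne : T.Nonempty)
    (hf : ∀ Ω, IsOpen Ω → Bornology.IsBounded Ω → ∀ i, IsCb01On (f i) (Ω \ T))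
    (hx₀ : x₀ ∈ Tᶜ) (hε : 0 < ε) :
    ∃ η > 0, ∃ Θ, ∀ᶠ x in 𝓝 x₀, ReachesLevel f T U x (U x - η) (U x + ε) Θ := by
  have hUx₀ := hU.continuousAt hT hx₀
  obtain ⟨δ, hδ, hball⟩ := Metric.mem_nhds_iff.1 (hUx₀.eventually_lt_const
    (lt_add_of_pos_right (U x₀) (half_pos hε)))
  obtain ⟨e, τ, hτ, he, hdec, hst⟩ := hU.hasLocalDescent hT hTne hf hx₀ hδ
  have hUe : ContinuousAt (fun x => U (e x)) x₀ :=
    (hU.continuousAt hT (hst.self_of_nhds.end_mem hτ.le).2).comp he.continuousAt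
  obtain ⟨η, hη, hgap⟩ : ∃ η > 0, U (e x₀) < U x₀ - η :=
    ⟨(U x₀ - U (e x₀)) / 2, by linarith, by linarith⟩
  refine ⟨η, hη, τ, ?_⟩
  filter_upwards [hst, hUe.eventually_lt (hUx₀.sub_const η) hgap,
    hUx₀.eventually_const_lt (sub_lt_self (U x₀) (half_pos hε))] with x hstx hex hx
  refine ⟨e x, τ, hτ, le_rfl, hstx.mono fun v hv => ⟨hv.2, ?_⟩, hex.le⟩
  have hv : U v < U x₀ + ε / 2 := hball hv.1
  linarith

theorem exists_forall_reachesLevel_half (hU : IsDegreeTwoCLF f T U) (hT : IsClosed T)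
    (hTne : T.Nonempty)
    (hf : ∀ Ω, IsOpen Ω → Bornology.IsBounded Ω → ∀ i, IsCb01On (f i) (Ω \ T))
    (ha : 0 < a) :
    ∃ Θ, ∀ x ∈ Tᶜ, a ≤ U x → U x ≤ b → ReachesLevel f T U x (U x / 2) (2 * U x) Θ := by
  have hshell : IsCompact (closure Tᶜ ∩ U ⁻¹' Icc (a / 2) b) :=
    hU.proper _ (fun r hr => (half_pos ha).le.trans hr.1) isCompact_Icc
  obtain ⟨η, hη, Θ, hstep⟩ := exists_forall_reachesLevel_of_isCompact hshell fun x hx =>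
    hU.exists_eventually_reachesLevel hT hTne hf
      (hU.mem_compl hx.1 ((half_pos ha).trans_le hx.2.1)) ha
  obtain ⟨N, hN⟩ := exists_nat_ge (b / η)
  rw [div_le_iff₀ hη] at hN
  refine ⟨(N + 1) * Θ, fun x hx hax hxb => ?_⟩
  have hstep_half : ∀ y ∈ Tᶜ, U x / 2 ≤ U y → U y ≤ b →
      ReachesLevel f T U y (U y - η) (U y + a) Θ := fun y hy hxy hyb =>
    hstep y ⟨subset_closure hy, by linarith, hyb⟩
  exact (ReachesLevel.of_forall_descent hstep_half hη.le N hx (by linarith) hxb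
    (by linarith)).mono le_rfl (by linarith) le_rfl

theorem exists_isHalvingStrategy (hU : IsDegreeTwoCLF f T U) (hT : IsClosed T)
    (hTne : T.Nonempty)
    (hf : ∀ Ω, IsOpen Ω → Bornology.IsBounded Ω → ∀ i, IsCb01On (f i) (Ω \ T)) :
    ∃ Z τ, IsHalvingStrategy f T U Z τ :=
  LieCLF.exists_isHalvingStrategy hU.pos fun _ _ ha =>
    hU.exists_forall_reachesLevel_half hT hTne hf ha

theorem exists_forall_infDist_le (hU : IsDegreeTwoCLF f T U) (b : ℝ) :
    ∃ R, ∀ x ∈ T ∪ sublevel T U b, Metric.infDist x T ≤ R := by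
  obtain ⟨R, hR⟩ := (hU.proper (Icc 0 b) (fun r hr => hr.1)
    isCompact_Icc).exists_bound_of_continuousOn (Metric.continuous_infDist_pt T).continuousOn
  refine ⟨max 0 R, ?_⟩
  rintro x (hx | ⟨hx, hxb⟩)
  · exact (Metric.infDist_zero_of_mem hx).trans_le (le_max_left _ _)
  · exact (le_abs_self _).trans ((hR x ⟨subset_closure hx, (hU.pos x hx).le, hxb⟩).trans
      (le_max_right _ _))

theorem exists_pos_forall_infDist_le (hU : IsDegreeTwoCLF f T U) (hε : 0 < ε) :
    ∃ b > 0, ∀ x ∈ T ∪ sublevel T U b, Metric.infDist x T ≤ ε := by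
  have hfar : IsCompact ((closure Tᶜ ∩ U ⁻¹' Icc 0 1) ∩ {x | ε ≤ Metric.infDist x T}) :=
    (hU.proper _ (fun r hr => hr.1) isCompact_Icc).inter_right
      (isClosed_le continuous_const (Metric.continuous_infDist_pt T))
  obtain ⟨b, hb, hle⟩ := hfar.exists_forall_le' (a := 0)
    (hU.continuousOn.mono (inter_subset_left.trans inter_subset_left)) fun x hx =>
      hU.pos x fun hxT => (hε.trans_le hx.2).ne' (Metric.infDist_zero_of_mem hxT)
  refine ⟨min 1 (b / 2), lt_min one_pos (half_pos hb), ?_⟩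
  rintro x (hx | ⟨hx, hxb⟩)
  · exact (Metric.infDist_zero_of_mem hx).trans_le hε.le
  · by_contra! hlt
    linarith [hle x ⟨⟨subset_closure hx, (hU.pos x hx).le, hxb.trans (min_le_left _ _)⟩, hlt.le⟩,
      hxb.trans (min_le_right _ _)]

theorem exists_forall_le (hU : IsDegreeTwoCLF f T U) (hTne : T.Nonempty)
    (hT_frontier : IsCompact (frontier T)) (R : ℝ) :
    ∃ b, ∀ x ∈ Tᶜ, Metric.infDist x T ≤ R → U x ≤ b := by
  obtain ⟨b, hb⟩ := (isCompact_infDist_le hTne hT_frontier R).exists_bound_of_continuousOn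
    (hU.continuousOn.mono inter_subset_left)
  exact ⟨b, fun x hx hxR => (le_abs_self _).trans (hb x ⟨subset_closure hx, hxR⟩)⟩

theorem exists_pos_forall_le (hU : IsDegreeTwoCLF f T U) (hT : IsClosed T) (hTne : T.Nonempty)
    (hT_frontier : IsCompact (frontier T)) (hb : 0 < b) :
    ∃ δ > 0, ∀ x ∈ Tᶜ, Metric.infDist x T ≤ δ → U x ≤ b := by
  have hnear := isCompact_infDist_le hTne hT_frontier 1
  have hhigh : IsCompact ((closure Tᶜ ∩ {x | Metric.infDist x T ≤ 1}) ∩ U ⁻¹' Ici b) :=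
    hnear.of_isClosed_subset ((hU.continuousOn.mono inter_subset_left).preimage_isClosed_of_isClosed
      hnear.isClosed isClosed_Ici) inter_subset_left
  obtain ⟨δ, hδ, hle⟩ := hhigh.exists_forall_le' (a := 0)
    (Metric.continuous_infDist_pt T).continuousOn fun x hx =>
      (hT.notMem_iff_infDist_pos hTne).1 (hU.mem_compl hx.1.1 (hb.trans_le hx.2))
  refine ⟨min 1 (δ / 2), lt_min one_pos (half_pos hδ), fun x hx hxδ => ?_⟩
  by_contra! hlt
  linarith [hle x ⟨⟨subset_closure hx, hxδ.trans (min_le_left _ _)⟩, hlt.le⟩,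
    hxδ.trans (min_le_right _ _)]

end IsDegreeTwoCLF

end Lyapunov

/-! ### Runs of a halving strategy -/

theorem coe_lt_iSup_coe {s : ℕ → ℝ} {t : ℝ} :
    (t : EReal) < ⨆ k, (s k : EReal) ↔ ∃ k, t < s k := by
  simp only [lt_iSup_iff, EReal.coe_lt_coe_iff]

theorem exists_mem_Ico_succ {s : ℕ → ℝ} {t : ℝ} (h0 : s 0 ≤ t) (ht : ∃ k, t < s k) :
    ∃ k, t ∈ Ico (s k) (s (k + 1)) := by
  by_contra! hcon
  obtain ⟨k, hk⟩ := ht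
  refine hk.not_ge (Nat.rec h0 (fun j hj => ?_) k)
  exact not_lt.1 fun hlt => hcon j ⟨hj, hlt⟩

section Strategy

variable {E : Type*} {Z : E → E} {τ : E → ℝ} {x : E}

/-- The time at which the strategy `Z`, used from `x` with legs of duration `τ`, has completed `k`
legs. -/
def switchTime (Z : E → E) (τ : E → ℝ) (x : E) (k : ℕ) : ℝ :=
  ∑ j ∈ Finset.range k, τ (Z^[j] x)

/-- The time, possibly infinite, at which the strategy `Z` with legs of duration `τ` has completed
all its legs from `x`. -/
noncomputable def finalTime (Z : E → E) (τ : E → ℝ) (x : E) : EReal :=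
  ⨆ k, (switchTime Z τ x k : EReal)

theorem switchTime_zero : switchTime Z τ x 0 = 0 :=
  Finset.sum_range_zero _

theorem switchTime_succ (k : ℕ) :
    switchTime Z τ x (k + 1) = switchTime Z τ x k + τ (Z^[k] x) :=
  Finset.sum_range_succ _ _

theorem exists_mem_leg {t : ℝ} (ht : 0 ≤ t) (htS : (t : EReal) < finalTime Z τ x) :
    ∃ k, t ∈ Ico (switchTime Z τ x k) (switchTime Z τ x (k + 1)) :=
  exists_mem_Ico_succ (switchTime_zero.trans_le ht) (coe_lt_iSup_coe.1 htS)

variable [NormedAddCommGroup E] [NormedSpace ℝ E] {m : ℕ} {f : Fin m → E → E} {T : Set E}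
  {U : E → ℝ} {a b Θ : ℝ}

namespace IsHalvingStrategy

theorem iterate_mem (hZ : IsHalvingStrategy f T U Z τ) (hx : x ∈ Tᶜ) (k : ℕ) : Z^[k] x ∈ Tᶜ := by
  induction k with
  | zero => exact hx
  | succ k ih =>
    rw [Function.iterate_succ_apply']
    exact ((hZ.steers _ ih).end_mem (hZ.time_pos _ ih).le).1

theorem iterate_le (hZ : IsHalvingStrategy f T U Z τ) (hx : x ∈ Tᶜ) (k : ℕ) :
    U (Z^[k] x) ≤ U x / 2 ^ k := by
  induction k with
  | zero => simp
  | succ k ih =>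
    rw [Function.iterate_succ_apply', pow_succ, ← div_div]
    exact (hZ.le_half _ (hZ.iterate_mem hx k)).trans (by gcongr)

theorem antitone_iterate (hZ : IsHalvingStrategy f T U Z τ) (hpos : ∀ x ∈ Tᶜ, 0 < U x)
    (hx : x ∈ Tᶜ) : Antitone fun k => U (Z^[k] x) :=
  antitone_nat_of_succ_le fun k => by
    have hk := hZ.iterate_mem hx k
    rw [Function.iterate_succ_apply']
    exact (hZ.le_half _ hk).trans (half_le_self (hpos _ hk).le)

theorem strictMono_switchTime (hZ : IsHalvingStrategy f T U Z τ) (hx : x ∈ Tᶜ) :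
    StrictMono (switchTime Z τ x) :=
  strictMono_nat_of_lt_succ fun k => by
    rw [switchTime_succ]
    exact lt_add_of_pos_right _ (hZ.time_pos _ (hZ.iterate_mem hx k))

theorem switchTime_lt_finalTime (hZ : IsHalvingStrategy f T U Z τ) (hx : x ∈ Tᶜ) (k : ℕ) :
    (switchTime Z τ x k : EReal) < finalTime Z τ x :=
  coe_lt_iSup_coe.2 ⟨k + 1, hZ.strictMono_switchTime hx k.lt_succ_self⟩

theorem exists_iterate_le (hZ : IsHalvingStrategy f T U Z τ) (hpos : ∀ x ∈ Tᶜ, 0 < U x)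
    (hx : x ∈ Tᶜ) (hΘ : 0 ≤ Θ) (hτ : ∀ z ∈ Tᶜ, a ≤ U z → U z ≤ b → τ z ≤ Θ) (hxb : U x ≤ b)
    {N : ℕ} (hN : b / 2 ^ N ≤ a) : ∃ k, U (Z^[k] x) ≤ a ∧ switchTime Z τ x k ≤ N * Θ := by
  classical
  have hN' : U (Z^[N] x) ≤ a := (hZ.iterate_le hx N).trans (le_trans (by gcongr) hN)
  have hex : ∃ k, U (Z^[k] x) ≤ a := ⟨N, hN'⟩
  refine ⟨Nat.find hex, Nat.find_spec hex, ?_⟩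
  have hleg : ∀ j ∈ Finset.range (Nat.find hex), τ (Z^[j] x) ≤ Θ := fun j hj =>
    hτ _ (hZ.iterate_mem hx j) (not_le.1 (Nat.find_min hex (Finset.mem_range.1 hj))).le
      ((hZ.antitone_iterate hpos hx j.zero_le).trans hxb)
  calc switchTime Z τ x (Nat.find hex) ≤ Nat.find hex * Θ := by
        simpa only [switchTime, Finset.card_range, nsmul_eq_mul] using
          Finset.sum_le_card_nsmul _ _ _ hleg
    _ ≤ N * Θ := by gcongr; exact Nat.find_min' hex hN'

end IsHalvingStrategy

/-- A trajectory-control pair that follows a halving strategy from `x`: its `k`-th leg starts at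
`Z^[k] x`. Past the last leg, if the strategy ends in finite time, it rests at a point of `∂T`. -/
structure IsHalvingRun (f : Fin m → E → E) (T : Set E) (U : E → ℝ) (Z : E → E) (τ : E → ℝ) (x : E)
    (y : ℝ → E) (α : ℝ → Fin m → ℝ) : Prop where
  init : y 0 = x
  measurable : Measurable α
  control_mem : ∀ t, α t ∈ controlSet m
  arc : ∀ k, IsArc f (sublevel T U (2 * U (Z^[k] x))) y α (switchTime Z τ x k)
    (switchTime Z τ x (k + 1))
  eq_of_finalTime_le : ∃ xbar ∈ frontier T, ∀ t : ℝ, finalTime Z τ x ≤ t → y t = xbar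

theorem IsHalvingStrategy.exists_isHalvingRun (hZ : IsHalvingStrategy f T U Z τ) (hx : x ∈ Tᶜ)
    (hT_frontier : (frontier T).Nonempty) : ∃ y α, IsHalvingRun f T U Z τ x y α := by
  obtain ⟨xbar, hxbar⟩ := hT_frontier
  obtain ⟨y, α, h0, hend, hα, hmem, harc⟩ :=
    exists_arcs_of_steers (x := fun k => Z^[k] x) (V := fun k => sublevel T U (2 * U (Z^[k] x)))
      switchTime_zero (hZ.strictMono_switchTime hx) (fun k => by
        rw [switchTime_succ, add_sub_cancel_left, Function.iterate_succ_apply']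
        exact hZ.steers _ (hZ.iterate_mem hx k)) xbar
  refine ⟨y, α, h0, hα, hmem, harc, xbar, hxbar, fun t ht => hend t fun k => ?_⟩
  exact not_lt.1 fun hlt => ht.not_gt (coe_lt_iSup_coe.2 ⟨k, hlt⟩)

namespace IsHalvingRun

variable {y : ℝ → E} {α : ℝ → Fin m → ℝ} {t : ℝ}

theorem mem_sublevel (hy : IsHalvingRun f T U Z τ x y α) (hZ : IsHalvingStrategy f T U Z τ)
    (hpos : ∀ x ∈ Tᶜ, 0 < U x) (hx : x ∈ Tᶜ) {k : ℕ} (hkt : switchTime Z τ x k ≤ t)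
    (htS : (t : EReal) < finalTime Z τ x) : y t ∈ sublevel T U (2 * U (Z^[k] x)) := by
  have hs := hZ.strictMono_switchTime hx
  have ht : 0 ≤ t := (switchTime_zero.symm.trans_le (hs.monotone k.zero_le)).trans hkt
  obtain ⟨j, hj⟩ := exists_mem_leg ht htS
  have hkj : k ≤ j := Nat.lt_succ_iff.1 (hs.lt_iff_lt.1 (hkt.trans_lt hj.2))
  exact sublevel_mono (mul_le_mul_of_nonneg_left (hZ.antitone_iterate hpos hx hkj) zero_le_two)
    ((hy.arc j).mem t (Ico_subset_Icc_self hj))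

theorem mem_union_sublevel (hy : IsHalvingRun f T U Z τ x y α)
    (hZ : IsHalvingStrategy f T U Z τ) (hpos : ∀ x ∈ Tᶜ, 0 < U x) (hT : IsClosed T) (hx : x ∈ Tᶜ)
    {k : ℕ} (hkt : switchTime Z τ x k ≤ t) : y t ∈ T ∪ sublevel T U (2 * U (Z^[k] x)) := by
  rcases lt_or_ge (t : EReal) (finalTime Z τ x) with htS | hSt
  · exact Or.inr (hy.mem_sublevel hZ hpos hx hkt htS)
  · obtain ⟨xbar, hxbar, heq⟩ := hy.eq_of_finalTime_le
    exact Or.inl (heq t hSt ▸ hT.frontier_subset hxbar)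

end IsHalvingRun

end Strategy

section Controllability

variable {n m : ℕ} {T : Set (State n)} {f : Fin m → State n → State n} {U : State n → ℝ}
  {Z : State n → State n} {τ : State n → ℝ} {x : State n}

theorem continuousOn_compl_of_isCb01On (hT : IsClosed T)
    (hf : ∀ Ω, IsOpen Ω → Bornology.IsBounded Ω → ∀ i, IsCb01On (f i) (Ω \ T)) (i : Fin m) :
    ContinuousOn (f i) Tᶜ := fun x hx => by
  obtain ⟨-, K, hK⟩ := hf (Metric.ball x 1) Metric.isOpen_ball Metric.isBounded_ball i
  exact (hK.continuousOn.continuousAt (inter_mem (Metric.ball_mem_nhds x one_pos)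
    (hT.isOpen_compl.mem_nhds hx))).continuousWithinAt

namespace IsHalvingRun

variable {y : ℝ → State n} {α : ℝ → Fin m → ℝ}

theorem isSolution (hy : IsHalvingRun f T U Z τ x y α) (hZ : IsHalvingStrategy f T U Z τ)
    (hf : ∀ i, ContinuousOn (f i) Tᶜ) (hx : x ∈ Tᶜ) :
    IsSolution f T x y α (finalTime Z τ x) := by
  refine isSolution_of_isArc hf ?_ hy.init hy.measurable hy.control_mem fun t ht htS => ?_
  · simpa only [switchTime_zero, EReal.coe_zero] using hZ.switchTime_lt_finalTime hx 0
  · obtain ⟨k, hk⟩ := exists_mem_leg ht htS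
    refine ⟨_, hk.2, ?_⟩
    rw [← switchTime_zero (Z := Z) (τ := τ) (x := x)]
    exact IsArc.of_forall_succ (hZ.strictMono_switchTime hx).monotone
      (fun j => (hy.arc j).mono fun _ hv => hv.1) k

theorem exists_infDist_lt (hy : IsHalvingRun f T U Z τ x y α) (hZ : IsHalvingStrategy f T U Z τ)
    (hU : IsDegreeTwoCLF f T U) (hT : IsClosed T) (hx : x ∈ Tᶜ) {ε : ℝ} (hε : 0 < ε) :
    ∃ k, ∀ t, switchTime Z τ x k ≤ t → Metric.infDist (y t) T < ε := by
  obtain ⟨b, hb, hdist⟩ := hU.exists_pos_forall_infDist_le (half_pos hε)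
  obtain ⟨k, hk⟩ := pow_unbounded_of_one_lt (2 * U x / b) one_lt_two
  have hkb : 2 * (U x / 2 ^ k) ≤ b := by
    rw [← mul_div_assoc]
    exact (div_le_comm₀ (by positivity) hb).2 hk.le
  refine ⟨k, fun t hkt => (hdist _ ?_).trans_lt (half_lt_self hε)⟩
  exact union_subset_union_right T
    (sublevel_mono ((mul_le_mul_of_nonneg_left (hZ.iterate_le hx k) zero_le_two).trans hkb))
    (hy.mem_union_sublevel hZ hU.pos hT hx hkt)

theorem isAdmissible (hy : IsHalvingRun f T U Z τ x y α) (hZ : IsHalvingStrategy f T U Z τ)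
    (hU : IsDegreeTwoCLF f T U) (hT : IsClosed T) (hf : ∀ i, ContinuousOn (f i) Tᶜ)
    (hx : x ∈ Tᶜ) : IsAdmissible f T x y α (finalTime Z τ x) := by
  have hlim : ∀ {l : Filter ℝ}, (∀ k, ∀ᶠ t in l, switchTime Z τ x k ≤ t) →
      Tendsto (fun t => Metric.infDist (y t) T) l (𝓝 0) := fun hl => by
    refine tendsto_order.2 ⟨fun ε hε => .of_forall fun t => hε.trans_le Metric.infDist_nonneg,
      fun ε hε => ?_⟩
    obtain ⟨k, hk⟩ := hy.exists_infDist_lt hZ hU hT hx hε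
    exact (hl k).mono hk
  refine ⟨hy.measurable, fun t _ => hy.control_mem t, hy.isSolution hZ hf hx,
    fun _ => hlim fun k => eventually_ge_atTop _, fun r hr => hlim fun k => ?_⟩
  have hkr := hZ.switchTime_lt_finalTime hx k
  rw [hr, EReal.coe_lt_coe_iff] at hkr
  filter_upwards [Ioo_mem_nhdsLT hkr] with t ht using ht.1.le

end IsHalvingRun

section Family

variable {y : {x // x ∈ Tᶜ} → ℝ → State n} {α : {x // x ∈ Tᶜ} → ℝ → Fin m → ℝ}

theorem uniformlyStable_infDist (hy : ∀ x, IsHalvingRun f T U Z τ x.1 (y x) (α x))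
    (hZ : IsHalvingStrategy f T U Z τ) (hU : IsDegreeTwoCLF f T U) (hT : IsClosed T)
    (hTne : T.Nonempty) (hT_frontier : IsCompact (frontier T)) :
    UniformlyStable (fun x : {x // x ∈ Tᶜ} => Metric.infDist x.1 T)
      fun x t => Metric.infDist (y x t) T := by
  intro ε hε
  obtain ⟨b, hb, hdist⟩ := hU.exists_pos_forall_infDist_le hε
  obtain ⟨δ, hδ, hval⟩ := hU.exists_pos_forall_le hT hTne hT_frontier (half_pos hb)
  refine ⟨δ, hδ, fun x hx t ht => hdist _ (union_subset_union_right T (sublevel_mono ?_)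
    ((hy x).mem_union_sublevel hZ hU.pos hT x.2 (switchTime_zero.trans_le ht)))⟩
  exact (le_div_iff₀' two_pos).1 (hval x.1 x.2 hx)

theorem uniformlyBounded_infDist (hy : ∀ x, IsHalvingRun f T U Z τ x.1 (y x) (α x))
    (hZ : IsHalvingStrategy f T U Z τ) (hU : IsDegreeTwoCLF f T U) (hT : IsClosed T)
    (hTne : T.Nonempty) (hT_frontier : IsCompact (frontier T)) :
    UniformlyBounded (fun x : {x // x ∈ Tᶜ} => Metric.infDist x.1 T)
      fun x t => Metric.infDist (y x t) T := by
  intro R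
  obtain ⟨b, hval⟩ := hU.exists_forall_le hTne hT_frontier R
  obtain ⟨M, hdist⟩ := hU.exists_forall_infDist_le (2 * b)
  refine ⟨M, fun x hx t ht => hdist _ (union_subset_union_right T (sublevel_mono ?_)
    ((hy x).mem_union_sublevel hZ hU.pos hT x.2 (switchTime_zero.trans_le ht)))⟩
  exact mul_le_mul_of_nonneg_left (hval x.1 x.2 hx) zero_le_two

theorem uniformlyAttractive_infDist (hy : ∀ x, IsHalvingRun f T U Z τ x.1 (y x) (α x))
    (hZ : IsHalvingStrategy f T U Z τ) (hU : IsDegreeTwoCLF f T U) (hT : IsClosed T)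
    (hTne : T.Nonempty) (hT_frontier : IsCompact (frontier T)) :
    UniformlyAttractive (fun x : {x // x ∈ Tᶜ} => Metric.infDist x.1 T)
      fun x t => Metric.infDist (y x t) T := by
  intro R ε hε
  obtain ⟨b, hval⟩ := hU.exists_forall_le hTne hT_frontier R
  obtain ⟨c, hc, hdist⟩ := hU.exists_pos_forall_infDist_le hε
  obtain ⟨Θ, hΘ, hτ⟩ := hZ.time_bounded (c / 2) b (half_pos hc)
  obtain ⟨N, hN⟩ := pow_unbounded_of_one_lt (b / (c / 2)) one_lt_two
  have hbN : b / 2 ^ N ≤ c / 2 := (div_le_comm₀ (by positivity) (half_pos hc)).2 hN.le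
  refine ⟨N * Θ, fun x hx t _ hNt => ?_⟩
  obtain ⟨k, hk, hkN⟩ := hZ.exists_iterate_le hU.pos x.2 hΘ hτ (hval x.1 x.2 hx) hbN
  exact hdist _ (union_subset_union_right T (sublevel_mono (by linarith))
    ((hy x).mem_union_sublevel hZ hU.pos hT x.2 (hkN.trans hNt)))

end Family

end Controllability

end LieCLF

theorem theorem4p1 (n m : ℕ) (T : Set (LieCLF.State n))
    (hT_closed : IsClosed T) (hT_nonempty : T.Nonempty) (hT_frontier : IsCompact (frontier T))
    (f : Fin m → LieCLF.State n → LieCLF.State n)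
    (hf : ∀ Ω : Set (LieCLF.State n), IsOpen Ω → Bornology.IsBounded Ω →
      ∀ i, LieCLF.IsCb01On (f i) (Ω \ T))
    (hU : ∃ U : LieCLF.State n → ℝ, LieCLF.IsDegreeTwoCLF f T U) :
    LieCLF.IsGAC f T := by
  obtain ⟨U, hU⟩ := hU
  obtain ⟨Z, τ, hZ⟩ := hU.exists_isHalvingStrategy hT_closed hT_nonempty hf
  have hrun : ∀ x : {x // x ∈ Tᶜ}, ∃ y α, LieCLF.IsHalvingRun f T U Z τ x.1 y α := fun x =>
    hZ.exists_isHalvingRun x.2 (nonempty_frontier_iff.2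
      ⟨hT_nonempty, fun h => x.2 (h ▸ mem_univ x.1)⟩)
  choose y α hy using hrun
  have hbounded := LieCLF.uniformlyBounded_infDist hy hZ hU hT_closed hT_nonempty hT_frontier
  have hstable := LieCLF.uniformlyStable_infDist hy hZ hU hT_closed hT_nonempty hT_frontier
  have hattractive := LieCLF.uniformlyAttractive_infDist hy hZ hU hT_closed hT_nonempty hT_frontier
  obtain ⟨β, hβ, hle⟩ := hbounded.exists_isKL hstable hattractive
    (fun x => (hT_closed.notMem_iff_infDist_pos hT_nonempty).1 x.2)
    fun _ _ _ => Metric.infDist_nonneg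
  have hf_cont := LieCLF.continuousOn_compl_of_isCb01On hT_closed hf
  exact ⟨β, hβ, fun x hx => ⟨y ⟨x, hx⟩, α ⟨x, hx⟩, LieCLF.finalTime Z τ x,
    (hy ⟨x, hx⟩).isAdmissible hZ hU hT_closed hf_cont hx, (hy ⟨x, hx⟩).eq_of_finalTime_le,
    hle ⟨x, hx⟩⟩⟩
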